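/- Let $\mathcal H$ be a complex Hilbert space, $D$ a (possibly unbounded) self-adjoint operator on $\mathcal H$ with spectral measure $E$, and $U$ a unitary operator on $\mathcal H$. Assume that the walk $(\mathcal H,(U^t)_{t\in\mathbb Z},D)$ is smooth, i.e. for every $t\in\mathbb Z$ the map $\mathbb R\ni k\mapsto e^{ikD}U^te^{-ikD}\in\mathcal B(\mathcal H)$ is $C^\infty$ in the operator norm. Let $\xi\in\bigcap_{m}\operatorname{dom}(D^m)$ be a unit vector (a smooth unit vector), and for $t\in\mathbb N$, $t\ge 1$, let $p_t$ be the Borel probability measure on $\mathbb R$ given by $p_t(\Omega)=\langle E(t\Omega)U^t\xi,U^t\xi\rangle$, i.e. the push-forward of $\langle E(\cdot)U^t\xi,U^t\xi\rangle$ under $x\mapsto x/t$. Then $U$ maps $\operatorname{dom}(D)$ into itself, the commutator $[D,U]=DU-UD$ is bounded on $\operatorname{dom}(D)$, and, with $\|[D,U]\|$ its operator norm, the following hold. 1. For every real $L>\|[D,U]\|$, $\displaystyle\lim_{t\to\infty}p_t\bigl((-\infty,-L]\cup[L,\infty)\bigr)=0$. 2. If $p_t$ converges weakly (against bounded continuous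 functions) to a Borel measure $p_\infty$ on $\mathbb R$, then the support of $p_\infty$ is compact. 3. For every Borel measure $p_\infty$ on $\mathbb R$, the measures $p_t$ converge weakly to $p_\infty$ if and only if their moments converge to those of $p_\infty$, i.e. for every integer $m\ge0$ the $m$-th moments of all $p_t$ and of $p_\infty$ are finite and $\displaystyle\lim_{t\to\infty}\int v^m\,p_t(dv)=\int v^m\,p_\infty(dv)$. -/

import Mathlib

open MeasureTheory Filter Topology
open scoped ContDiff InnerProductSpace BoundedContinuousFunction

noncomputable section

/-- A projection-valued Borel measure on the real line: orthogonal projections `proj s`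
(for Borel sets `s`), countably additive in the strong operator topology, with `proj ℝ = 1`.
The values of `proj` on non-Borel sets are irrelevant. -/
structure ProjectionValuedMeasure (H : Type*) [NormedAddCommGroup H] [InnerProductSpace ℂ H]
    [CompleteSpace H] where
  proj : Set ℝ → (H →L[ℂ] H)
  isStarProjection : ∀ s, MeasurableSet s → IsStarProjection (proj s)
  proj_univ : proj Set.univ = 1
  hasSum_iUnion : ∀ s : ℕ → Set ℝ, (∀ n, MeasurableSet (s n)) →
    Pairwise (fun m n => Disjoint (s m) (s n)) →
    ∀ ξ : H, HasSum (fun n => proj (s n) ξ) (proj (⋃ n, s n) ξ)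

namespace ProjectionValuedMeasure

variable {H : Type*} [NormedAddCommGroup H] [InnerProductSpace ℂ H] [CompleteSpace H]

theorem proj_empty (E : ProjectionValuedMeasure H) : E.proj ∅ = 0 := by
  ext ξ
  have h := (E.hasSum_iUnion (fun _ => ∅) (fun _ => MeasurableSet.empty)
    (fun _ _ _ => disjoint_bot_left) ξ).summable
  simpa using (summable_const_iff _).1 h

theorem inner_proj_nonneg (E : ProjectionValuedMeasure H) (ξ : H) {s : Set ℝ}
    (hs : MeasurableSet s) : 0 ≤ (⟪ξ, E.proj s ξ⟫_ℂ).re := by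
  have hP := E.isStarProjection s hs
  have h1 : E.proj s (E.proj s ξ) = E.proj s ξ :=
    DFunLike.congr_fun hP.isIdempotentElem.eq ξ
  have h2 : ⟪ξ, E.proj s ξ⟫_ℂ = ⟪E.proj s ξ, E.proj s ξ⟫_ℂ := by
    conv_lhs => rw [← h1]
    rw [← ContinuousLinearMap.adjoint_inner_left, hP.isSelfAdjoint.adjoint_eq]
  rw [h2]
  exact inner_self_nonneg (𝕜 := ℂ)

/-- The positive measure `s ↦ ⟨E(s) ξ, ξ⟩` on the real line. -/
def measure (E : ProjectionValuedMeasure H) (ξ : H) : Measure ℝ :=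
  Measure.ofMeasurable (fun s _ => ENNReal.ofReal (⟪ξ, E.proj s ξ⟫_ℂ).re)
    (by simp [E.proj_empty])
    (by
      intro s hs hd
      have h := E.hasSum_iUnion s hs (fun m n hmn => hd hmn) ξ
      have h' : HasSum (fun n => (⟪ξ, E.proj (s n) ξ⟫_ℂ).re)
          (⟪ξ, E.proj (⋃ n, s n) ξ⟫_ℂ).re :=
        Complex.hasSum_re (h.mapL (innerSL ℂ ξ))
      rw [← h'.tsum_eq]
      exact ENNReal.ofReal_tsum_of_nonneg (fun n => E.inner_proj_nonneg ξ (hs n)) h'.summable)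

/-- `D = ∫ x dE(x)`: the domain of `D` consists of the vectors `ξ` with
`∫ x² ⟨E(dx) ξ, ξ⟩ < ∞`, and `⟨D ξ, ξ⟩ = ∫ x ⟨E(dx) ξ, ξ⟩` on it
(by polarization this determines `D`). -/
def Represents (E : ProjectionValuedMeasure H) (D : H →ₗ.[ℂ] H) : Prop :=
  (∀ ξ : H, ξ ∈ D.domain ↔ Integrable (fun x : ℝ => x ^ 2) (E.measure ξ)) ∧
  ∀ ξ : D.domain, ⟪(ξ : H), D ξ⟫_ℂ = ((∫ x : ℝ, x ∂(E.measure (ξ : H)) : ℝ) : ℂ)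

/-- The projection-valued measure concentrated at the point `0`. -/
def diracZero (H : Type*) [NormedAddCommGroup H] [InnerProductSpace ℂ H] [CompleteSpace H] :
    ProjectionValuedMeasure H where
  proj s := Set.indicator s (fun _ => 1) 0
  isStarProjection s _ := by
    by_cases h : (0 : ℝ) ∈ s
    · simp [h, IsStarProjection.one]
    · simp [h, IsStarProjection.zero]
  proj_univ := by simp
  hasSum_iUnion s _ hd ξ := by
    by_cases h : (0 : ℝ) ∈ ⋃ n, s n
    · obtain ⟨n, hn⟩ := Set.mem_iUnion.1 h
      have h0 : ∀ m, m ≠ n →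
          (Set.indicator (s m) (fun _ => (1 : H →L[ℂ] H)) 0) ξ = 0 := by
        intro m hm
        have : (0 : ℝ) ∉ s m := fun h' => Set.disjoint_left.1 (hd hm) h' hn
        simp [this]
      have h1 := hasSum_single n h0
      rw [Set.indicator_of_mem hn] at h1
      rw [Set.indicator_of_mem h]
      exact h1
    · have h' : ∀ n, (0 : ℝ) ∉ s n := fun n hn => h (Set.mem_iUnion.2 ⟨n, hn⟩)
      rw [Set.indicator_of_notMem h]
      simp [h', hasSum_zero]

instance : Nonempty (ProjectionValuedMeasure H) := ⟨diracZero H⟩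

/-- The bounded operator `∫ g dE` for a bounded Borel function `g`: the unique bounded operator
`T` with `⟨T ξ, ξ⟩ = ∫ g(x) ⟨E(dx) ξ, ξ⟩` for all `ξ`. -/
def integral (E : ProjectionValuedMeasure H) (g : ℝ → ℂ) : H →L[ℂ] H :=
  Classical.epsilon fun T : H →L[ℂ] H =>
    ∀ ξ : H, ⟪ξ, T ξ⟫_ℂ = ∫ x : ℝ, g x ∂(E.measure ξ)

end ProjectionValuedMeasure

namespace QuantumWalk

variable {H : Type*} [NormedAddCommGroup H] [InnerProductSpace ℂ H] [CompleteSpace H]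

/-- The spectral measure of a self-adjoint operator `D`: the (unique, by the spectral theorem)
projection-valued measure `E` with `D = ∫ x dE(x)`. -/
def spectralMeasure (D : H →ₗ.[ℂ] H) : ProjectionValuedMeasure H :=
  Classical.epsilon fun E : ProjectionValuedMeasure H => E.Represents D

/-- The unitary operator `e^{ikD}`, by functional calculus. -/
def expI (D : H →ₗ.[ℂ] H) (k : ℝ) : H →L[ℂ] H :=
  (spectralMeasure D).integral fun x : ℝ => Complex.exp (Complex.I * k * x)

/-- A bounded operator `X` is smooth with respect to `D` if `k ↦ e^{ikD} X e^{-ikD}` is a smooth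
map from the real line to the bounded operators with the operator norm. -/
def IsSmoothOperator (D : H →ₗ.[ℂ] H) (X : H →L[ℂ] H) : Prop :=
  ContDiff ℝ ∞ fun k : ℝ => expI D k * X * expI D (-k)

/-- The walk `(H, (U^t)_{t ∈ ℤ}, D)` is smooth if every `U^t` is smooth with respect to `D`. -/
def IsSmoothWalk (D : H →ₗ.[ℂ] H) (U : unitary (H →L[ℂ] H)) : Prop :=
  ∀ t : ℤ, IsSmoothOperator D ((U ^ t : unitary (H →L[ℂ] H)) : H →L[ℂ] H)

/-- `ξ` belongs to the domain of `D ^ m`. -/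
def MemDomainPow (D : H →ₗ.[ℂ] H) : ℕ → H → Prop
  | 0, _ => True
  | m + 1, ξ => ∃ h : ξ ∈ D.domain, MemDomainPow D m (D ⟨ξ, h⟩)

/-- `ξ` is smooth with respect to `D` if it lies in the domain of all powers of `D`. -/
def IsSmoothVector (D : H →ₗ.[ℂ] H) (ξ : H) : Prop :=
  ∀ m : ℕ, MemDomainPow D m ξ

/-- The operator norm, in `[0, ∞]`, of the commutator `[D, X] = D X - X D`, defined on the vectors
`ξ` in the domain of `D` such that `X ξ` is in the domain of `D`. -/
def commutatorNorm (D : H →ₗ.[ℂ] H) (X : H →L[ℂ] H) : ENNReal :=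
  ⨆ (ξ : D.domain) (h : X ξ ∈ D.domain) (_ : ‖(ξ : H)‖ ≤ 1), ‖D ⟨X ξ, h⟩ - X (D ξ)‖ₑ

/-- The rescaled position distribution `p_t`: the push-forward of `⟨E(·) U^t ξ, U^t ξ⟩` under
`x ↦ x / t`, with `E` the spectral measure of `D`. (Only positive `t` matter.) -/
def positionDistribution (D : H →ₗ.[ℂ] H) (U : unitary (H →L[ℂ] H)) (ξ : H) (t : ℕ) :
    Measure ℝ :=
  ((spectralMeasure D).measure (((U ^ t : unitary (H →L[ℂ] H)) : H →L[ℂ] H) ξ)).map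
    fun x : ℝ => x / t

/-- Weak convergence of Borel measures on the real line, tested on bounded continuous functions. -/
def WeaklyConvergesTo (p : ℕ → Measure ℝ) (q : Measure ℝ) : Prop :=
  IsFiniteMeasure q ∧
    ∀ f : ℝ →ᵇ ℝ, Tendsto (fun t => ∫ v, f v ∂(p t)) atTop (𝓝 (∫ v, f v ∂q))

/-- Convergence of all moments (of order `m = 0, 1, 2, …`), all moments being finite. -/
def MomentsConvergeTo (p : ℕ → Measure ℝ) (q : Measure ℝ) : Prop :=
  ∀ m : ℕ, (∀ t, Integrable (fun v : ℝ => v ^ m) (p t)) ∧ Integrable (fun v : ℝ => v ^ m) q ∧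
    Tendsto (fun t => ∫ v, v ^ m ∂(p t)) atTop (𝓝 (∫ v, v ^ m ∂q))

end QuantumWalk

end

/-! The spectral measure and `e^{ikD}` are defined by choice, so the spectral theorem comes first.
For self-adjoint `D` the resolvent `R = (D + i)⁻¹` is bounded and normal. Its continuous functional
calculus and Riesz–Markov give a measure on the spectrum of `R` for each vector. Pushed forward
under `z ↦ Re z⁻¹`, these measures come from a projection-valued measure that represents `D`
(`exists_represents`). A bounded Borel calculus then gives the unitary group, with Stone's relation:
`k ↦ e^{ikD} ξ` is differentiable at `0` exactly when `ξ ∈ dom D`, with derivative `i D ξ`.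

The core is a translation of moments into derivatives: the `2m`-th moment of `⟨E(·)η, η⟩` equals
`‖∂ₖᵐ e^{ikD} η‖²` at `k = 0` (`moment_eq`). Since `e^{ikD} U η = (e^{ikD} U e^{-ikD}) (e^{ikD} η)`,
the Leibniz rule bounds `F(t, m)`, the norm of the `m`-th derivative for `η = U^t ξ`, by the
recursion `F(t+1, m) ≤ ∑ᵢ (m choose i) aᵢ F(t, m-i)`. Here `aᵢ` is the norm of the `i`-th derivative
of `e^{ikD} U e^{-ikD}` at `0`, so `a₀ ≤ 1` and `a₁ ≤ ‖[D, U]‖`. Terms with `i ≥ 2` are of lower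
order in `t`, so `F(t, m) ≤ c'^m (t + K)^m` for every `c' > ‖[D, U]‖`, with `K` depending on `m`
(`exists_growth_bound`). After rescaling, the `2m`-th moment of `p_t` is eventually at most
`c'^(2m)`.

Everything else follows from these bounds (`Controlled`). Markov's inequality with arbitrarily high
moments makes `∫ |v|^m` over `|v| ≥ L` tend to `0` for every `L > ‖[D, U]‖`, and a limit measure has
no mass there. With negligible tails, monomials can be truncated to bounded continuous functions,
and bounded continuous functions can be replaced by polynomials on a compact interval, so weak and
moment convergence agree. -/

set_option linter.unusedSectionVars false

/-! ### Spectral measures of representations of `C(X, ℂ)` -/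

namespace SpectralRep

variable {H : Type*} [NormedAddCommGroup H] [InnerProductSpace ℂ H] [CompleteSpace H]

theorem clm_ext_inner {S T : H →L[ℂ] H} (h : ∀ ξ : H, ⟪ξ, S ξ⟫_ℂ = ⟪ξ, T ξ⟫_ℂ) : S = T := by
  have : (S : H →ₗ[ℂ] H) = T := by
    rw [← ext_inner_map]
    intro x
    rw [← inner_conj_symm, ← inner_conj_symm (T.toLinearMap x)]
    exact congrArg _ (h x)
  ext x
  exact DFunLike.congr_fun this x

variable {X : Type*} [TopologicalSpace X]

/-- A real-valued continuous function, seen as a complex-valued one. -/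
def complexify (f : C(X, ℝ)) : C(X, ℂ) := ⟨fun x => (f x : ℂ), by fun_prop⟩

@[simp] theorem complexify_apply (f : C(X, ℝ)) (x : X) : complexify f x = (f x : ℂ) := rfl

variable (π : C(X, ℂ) →⋆ₐ[ℂ] (H →L[ℂ] H))

theorem inner_map_mul (f g : C(X, ℂ)) (ξ η : H) :
    ⟪π f ξ, π g η⟫_ℂ = ⟪ξ, π (star f * g) η⟫_ℂ := by
  rw [map_mul, map_star, mul_apply_eq_comp, ContinuousLinearMap.star_eq_adjoint,
    ContinuousLinearMap.adjoint_inner_right]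

/-- A nonnegative function is `star g * g` with `g = √f`, so its form is `‖π g ξ‖²`. -/
theorem inner_map_nonneg (f : C(X, ℝ)) (hf : 0 ≤ f) (ξ : H) :
    0 ≤ (⟪ξ, π (complexify f) ξ⟫_ℂ).re := by
  set g : C(X, ℂ) := ⟨fun x => (Real.sqrt (f x) : ℂ), by fun_prop⟩ with hg
  have : complexify f = star g * g := by
    ext x
    simp only [complexify_apply, ContinuousMap.mul_apply, ContinuousMap.star_apply, hg,
      ContinuousMap.coe_mk, Complex.star_def, Complex.conj_ofReal]
    rw [← Complex.ofReal_mul]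
    exact congrArg _ (Real.mul_self_sqrt (hf x)).symm
  rw [this, ← inner_map_mul]
  exact inner_self_nonneg (𝕜 := ℂ)

theorem complexify_add (f g : C(X, ℝ)) : complexify (f + g) = complexify f + complexify g := by
  ext x; simp

theorem complexify_smul (c : ℝ) (f : C(X, ℝ)) :
    complexify (c • f) = (c : ℂ) • complexify f := by
  ext x; simp

theorem inner_complexify_im (f : C(X, ℝ)) (ξ : H) : (⟪ξ, π (complexify f) ξ⟫_ℂ).im = 0 := by
  have hs : star (complexify f) = complexify f := by
    ext x; simp
  have h : ⟪π (complexify f) ξ, ξ⟫_ℂ = ⟪ξ, π (complexify f) ξ⟫_ℂ := by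
    have := inner_map_mul π (complexify f) 1 ξ ξ
    simpa [hs] using this
  rw [← inner_conj_symm] at h
  exact Complex.conj_eq_iff_im.1 h

variable [TopologicalSpace.PseudoMetrizableSpace X] [T2Space X] [CompactSpace X] [MeasurableSpace X] [BorelSpace X]

/-- Riesz–Markov–Kakutani for the positive functional `f ↦ Re ⟨ξ, π f ξ⟩` on real functions; complex
functions follow by splitting into real and imaginary parts. -/
theorem exists_measure (ξ : H) :
    ∃ ν : Measure X, IsFiniteMeasure ν ∧ ∀ f : C(X, ℂ), ∫ x, f x ∂ν = ⟪ξ, π f ξ⟫_ℂ := by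
  let Λ : CompactlySupportedContinuousMap X ℝ →ₚ[ℝ] ℝ :=
    { toFun f := (⟪ξ, π (complexify f.toContinuousMap) ξ⟫_ℂ).re
      map_add' f g := by
        have : (f + g).toContinuousMap = f.toContinuousMap + g.toContinuousMap := rfl
        rw [this, complexify_add, map_add, add_apply, inner_add_right,
          Complex.add_re]
      map_smul' c f := by
        have : (c • f).toContinuousMap = c • f.toContinuousMap := rfl
        rw [this, complexify_smul, map_smul, smul_apply, inner_smul_right,
          Complex.re_ofReal_mul]
        rfl
      monotone' f g hfg := by
        have h : g.toContinuousMap = f.toContinuousMap + (g.toContinuousMap - f.toContinuousMap) :=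
          by abel
        have h0 : 0 ≤ g.toContinuousMap - f.toContinuousMap := fun x => sub_nonneg.2 (hfg x)
        have := inner_map_nonneg π _ h0 ξ
        dsimp only
        rw [h, complexify_add, map_add, add_apply, inner_add_right,
          Complex.add_re]
        linarith }
  refine ⟨RealRMK.rieszMeasure Λ, inferInstance, fun f => ?_⟩
  have key : ∀ g : C(X, ℝ), ((∫ x, g x ∂(RealRMK.rieszMeasure Λ) : ℝ) : ℂ)
      = ⟪ξ, π (complexify g) ξ⟫_ℂ := by
    intro g
    have := RealRMK.integral_rieszMeasure Λ ⟨g, HasCompactSupport.of_compactSpace _⟩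
    have h2 : ∫ x, g x ∂(RealRMK.rieszMeasure Λ) = (⟪ξ, π (complexify g) ξ⟫_ℂ).re := this
    rw [h2]
    exact Complex.ext rfl (inner_complexify_im π g ξ).symm
  have hint : ∀ g : C(X, ℝ), Integrable (fun x => (g x : ℂ)) (RealRMK.rieszMeasure Λ) := fun g =>
    ((complexify g).continuous.integrable_of_hasCompactSupport
      (HasCompactSupport.of_compactSpace _))
  let u : C(X, ℝ) := ⟨fun x => (f x).re, by fun_prop⟩
  let v : C(X, ℝ) := ⟨fun x => (f x).im, by fun_prop⟩
  have hf : f = complexify u + Complex.I • complexify v := by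
    ext x
    simp only [ContinuousMap.add_apply, ContinuousMap.smul_apply, complexify_apply, smul_eq_mul,
      mul_comm Complex.I]
    exact (Complex.re_add_im _).symm
  have h1 : ∀ x, f x = (u x : ℂ) + Complex.I * (v x : ℂ) := fun x => by
    conv_lhs => rw [hf]
    simp
  simp_rw [h1]
  rw [integral_add (hint u) ((hint v).const_mul _), integral_const_mul,
    integral_complex_ofReal, integral_complex_ofReal]
  erw [key u, key v]
  conv_rhs => rw [hf]
  simp

/-- The spectral measure of a vector `ξ` for a representation of `C(X, ℂ)`. -/
noncomputable def vecMeasure (ξ : H) : Measure X := (exists_measure π ξ).choose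

instance (ξ : H) : IsFiniteMeasure (vecMeasure π ξ) := (exists_measure π ξ).choose_spec.1

theorem integral_vecMeasure (ξ : H) (f : C(X, ℂ)) :
    ∫ x, f x ∂(vecMeasure π ξ) = ⟪ξ, π f ξ⟫_ℂ := (exists_measure π ξ).choose_spec.2 f

theorem integrable_vecMeasure {F : Type*} [NormedAddCommGroup F] (ξ : H) {f : X → F}
    (hf : Continuous f) : Integrable f (vecMeasure π ξ) :=
  hf.integrable_of_hasCompactSupport (HasCompactSupport.of_compactSpace _)

/-- The map `f ↦ π f ξ` is isometric for the `L²` norm of the vector's measure, so convergence in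
`H` reduces to convergence of integrals. -/
theorem norm_map_sq (ξ : H) (f : C(X, ℂ)) :
    ‖π f ξ‖ ^ 2 = ∫ x, ‖f x‖ ^ 2 ∂(vecMeasure π ξ) := by
  have h := inner_map_mul π f f ξ ξ
  rw [← integral_vecMeasure, inner_self_eq_norm_sq_to_K] at h
  have h2 : ∀ x, (star f * f) x = ((‖f x‖ ^ 2 : ℝ) : ℂ) := fun x => by
    simp [Complex.conj_mul']
  simp_rw [h2] at h
  rw [integral_complex_ofReal] at h
  exact Complex.ofReal_injective (by simpa using h)

theorem norm_map_sub_sq (ξ : H) (f g : C(X, ℂ)) :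
    ‖π f ξ - π g ξ‖ ^ 2 = ∫ x, ‖f x - g x‖ ^ 2 ∂(vecMeasure π ξ) := by
  have := norm_map_sq π ξ (f - g)
  simpa using this

theorem vecMeasure_univ (ξ : H) : (vecMeasure π ξ).real Set.univ = ‖ξ‖ ^ 2 := by
  have := norm_map_sq π ξ 1
  simpa using this.symm

/-- Continuous functions with values in `[0, 1]` converging in mean to the indicator of `s`. -/
def Approximates (μ : Measure X) (s : Set X) (f : ℕ → C(X, ℝ)) : Prop :=
  (∀ n x, f n x ∈ Set.Icc (0 : ℝ) 1) ∧
    Tendsto (fun n => ∫ x, |f n x - s.indicator 1 x| ∂μ) atTop (𝓝 0)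

omit [TopologicalSpace X] [TopologicalSpace.PseudoMetrizableSpace X] [T2Space X] [CompactSpace X] [BorelSpace X] in
theorem integrable_indicator_one (μ : Measure X) [IsFiniteMeasure μ] {s : Set X}
    (hs : MeasurableSet s) : Integrable (s.indicator (1 : X → ℝ)) μ :=
  (integrable_const (1 : ℝ)).indicator hs

theorem integrable_abs_sub_indicator (μ : Measure X) [IsFiniteMeasure μ] {s : Set X}
    (hs : MeasurableSet s) (f : C(X, ℝ)) :
    Integrable (fun x => |f x - s.indicator 1 x|) μ :=
  ((f.continuous.integrable_of_hasCompactSupport (HasCompactSupport.of_compactSpace _)).sub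
    ((integrable_const (1 : ℝ)).indicator hs)).abs

theorem Approximates.mono {μ ν : Measure X} [IsFiniteMeasure μ] (h : ν ≤ μ) {s : Set X}
    (hs : MeasurableSet s) {f : ℕ → C(X, ℝ)} (hf : Approximates μ s f) : Approximates ν s f := by
  refine ⟨hf.1, squeeze_zero (fun n => integral_nonneg fun x => abs_nonneg _) (fun n => ?_) hf.2⟩
  exact integral_mono_measure h (ae_of_all _ fun x => abs_nonneg _)
    (integrable_abs_sub_indicator μ hs (f n))

theorem exists_approximates (μ : Measure X) [IsFiniteMeasure μ]
    {s : Set X} (hs : MeasurableSet s) : ∃ f, Approximates μ s f := by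
  have hi : Integrable (s.indicator (1 : X → ℝ)) μ := (integrable_const (1 : ℝ)).indicator hs
  have : ∀ n : ℕ, ∃ f : C(X, ℝ), (∀ x, f x ∈ Set.Icc (0 : ℝ) 1) ∧
      ∫ x, |f x - s.indicator 1 x| ∂μ ≤ 1 / ((n : ℝ) + 1) := by
    intro n
    obtain ⟨g, hg, hgi⟩ := hi.exists_boundedContinuous_integral_sub_le
      (ε := 1 / ((n : ℝ) + 1)) (by positivity)
    refine ⟨⟨fun x => max 0 (min (g x) 1), by fun_prop⟩, fun x => ⟨le_max_left _ _,
      max_le zero_le_one (min_le_right _ _)⟩, le_trans ?_ hg⟩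
    refine integral_mono (integrable_abs_sub_indicator μ hs _) (hi.sub hgi).norm fun x => ?_
    simp only [ContinuousMap.coe_mk, Real.norm_eq_abs]
    rw [abs_sub_comm]
    by_cases hx : x ∈ s
    · rw [Set.indicator_of_mem hx]
      simp only [Pi.one_apply]
      rcases max_cases 0 (min (g x) 1) with h | h <;> rcases min_cases (g x) 1 with h' | h' <;>
        rw [abs_le] <;> constructor <;>
        cases abs_cases (1 - g x) <;> linarith
    · rw [Set.indicator_of_notMem hx]
      rcases max_cases 0 (min (g x) 1) with h | h <;> rcases min_cases (g x) 1 with h' | h' <;>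
        rw [abs_le] <;> constructor <;>
        cases abs_cases (0 - g x) <;> linarith
  choose f hf1 hf2 using this
  exact ⟨f, hf1, squeeze_zero (fun n => integral_nonneg fun x => abs_nonneg _) hf2
    tendsto_one_div_add_atTop_nhds_zero_nat⟩

/-- Values in `[0, 1]` give `|f - g|² ≤ |f - g|`, which turns approximation in mean into
approximation in `L²`. -/
theorem norm_map_sub_sq_le (ξ : H) {s : Set X} (hs : MeasurableSet s) (f g : C(X, ℝ))
    (hf : ∀ x, f x ∈ Set.Icc (0 : ℝ) 1) (hg : ∀ x, g x ∈ Set.Icc (0 : ℝ) 1) :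
    ‖π (complexify f) ξ - π (complexify g) ξ‖ ^ 2 ≤
      ∫ x, |f x - s.indicator 1 x| ∂(vecMeasure π ξ) +
      ∫ x, |g x - s.indicator 1 x| ∂(vecMeasure π ξ) := by
  have i1 := integrable_abs_sub_indicator (vecMeasure π ξ) hs f
  have i2 := integrable_abs_sub_indicator (vecMeasure π ξ) hs g
  rw [norm_map_sub_sq, ← integral_add i1 i2]
  refine integral_mono (integrable_vecMeasure π ξ (by fun_prop)) (i1.add i2) fun x => ?_
  simp only [complexify_apply]
  rw [← Complex.ofReal_sub, Complex.norm_real, Real.norm_eq_abs]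
  have h1 : |f x - g x| ≤ 1 := by
    rw [abs_le]; constructor <;> linarith [(hf x).1, (hf x).2, (hg x).1, (hg x).2]
  have h2 : |f x - g x| ≤ |f x - s.indicator 1 x| + |g x - s.indicator 1 x| := by
    rw [abs_sub_comm (g x)]
    exact abs_sub_le _ _ _
  nlinarith [abs_nonneg (f x - g x)]

/-- The limit plays the role of `1_s` applied to `ξ`. Its independence of the approximating sequence
is what later makes it linear in `ξ`. -/
theorem exists_limit (ξ : H) {s : Set X} (hs : MeasurableSet s)  :
    ∃ v : H, ∀ f, Approximates (vecMeasure π ξ) s f →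
      Tendsto (fun n => π (complexify (f n)) ξ) atTop (𝓝 v) := by
  obtain ⟨f, hf⟩ := exists_approximates (vecMeasure π ξ) hs
  have hc : CauchySeq fun n => π (complexify (f n)) ξ := by
    rw [Metric.cauchySeq_iff']
    intro ε hε
    have hε2 : 0 < ε ^ 2 / 2 := by positivity
    obtain ⟨N, hN⟩ := eventually_atTop.1 (hf.2.eventually (gt_mem_nhds hε2))
    refine ⟨N, fun n hn => ?_⟩
    rw [dist_eq_norm]
    refine lt_of_pow_lt_pow_left₀ 2 hε.le ?_
    have := norm_map_sub_sq_le π ξ hs (f n) (f N) (hf.1 n) (hf.1 N)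
    linarith [hN n hn, hN N le_rfl]
  obtain ⟨v, hv⟩ := cauchySeq_tendsto_of_complete hc
  refine ⟨v, fun g hg => ?_⟩
  have h0 : Tendsto (fun n => ‖π (complexify (g n)) ξ - π (complexify (f n)) ξ‖ ^ 2) atTop
      (𝓝 0) := by
    refine squeeze_zero (fun n => by positivity)
      (fun n => norm_map_sub_sq_le π ξ hs (g n) (f n) (hg.1 n) (hf.1 n)) ?_
    simpa using hg.2.add hf.2
  have h1 : Tendsto (fun n => π (complexify (g n)) ξ - π (complexify (f n)) ξ) atTop (𝓝 0) := by
    rw [tendsto_zero_iff_norm_tendsto_zero]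
    have := h0.sqrt
    simpa using this
  simpa using h1.add hv

theorem tendsto_inner_of_approximates (ξ : H) {s : Set X} (hs : MeasurableSet s)
    {f : ℕ → C(X, ℝ)} (hf : Approximates (vecMeasure π ξ) s f) :
    Tendsto (fun n => ⟪ξ, π (complexify (f n)) ξ⟫_ℂ) atTop
      (𝓝 (((vecMeasure π ξ).real s : ℝ) : ℂ)) := by
  have h : Tendsto (fun n => ∫ x, f n x ∂(vecMeasure π ξ)) atTop
      (𝓝 ((vecMeasure π ξ).real s)) := by
    rw [tendsto_iff_norm_sub_tendsto_zero]
    refine squeeze_zero (fun n => norm_nonneg _) (fun n => ?_) hf.2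
    rw [← integral_indicator_one hs, ← integral_sub (integrable_vecMeasure π ξ (f n).continuous)
      (integrable_indicator_one _ hs)]
    exact norm_integral_le_integral_norm _
  have := (Complex.continuous_ofReal.tendsto _).comp h
  refine this.congr fun n => ?_
  rw [← integral_vecMeasure]
  simp only [complexify_apply, Function.comp]
  rw [integral_complex_ofReal]

theorem tendsto_norm_sq_of_approximates (ξ : H) {s : Set X} (hs : MeasurableSet s)
    {f : ℕ → C(X, ℝ)} (hf : Approximates (vecMeasure π ξ) s f) :
    Tendsto (fun n => ‖π (complexify (f n)) ξ‖ ^ 2) atTop (𝓝 ((vecMeasure π ξ).real s)) := by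
  rw [tendsto_iff_norm_sub_tendsto_zero]
  refine squeeze_zero (fun n => norm_nonneg _) (fun n => ?_)
    (by simpa using hf.2.const_mul 2)
  rw [norm_map_sq, ← integral_indicator_one hs,
    ← integral_sub (integrable_vecMeasure π ξ (by fun_prop))
      (integrable_indicator_one _ hs), ← integral_const_mul]
  refine (norm_integral_le_integral_norm _).trans (integral_mono
    ((integrable_vecMeasure π ξ (by fun_prop)).sub
      (integrable_indicator_one _ hs)).norm
    ((integrable_abs_sub_indicator _ hs (f n)).const_mul 2) fun x => ?_)
  have h01 := hf.1 n x
  simp only [complexify_apply, Complex.norm_real, Real.norm_eq_abs, sq_abs]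
  by_cases hx : x ∈ s
  · rw [Set.indicator_of_mem hx, Pi.one_apply]
    rw [show f n x ^ 2 - 1 = (f n x + 1) * (f n x - 1) by ring, abs_mul]
    gcongr
    rw [abs_le]; constructor <;> linarith [h01.1, h01.2]
  · rw [Set.indicator_of_notMem hx, sub_zero, sub_zero, abs_of_nonneg (sq_nonneg _),
      abs_of_nonneg h01.1]
    nlinarith [h01.1, h01.2]

/-- The operator sends `ξ` to the limit vector of `exists_limit`. Having both the form and the
squared norm equal to the mass of `s` encodes `P* P = P`, hence that `P` is an orthogonal
projection. -/
theorem exists_proj {s : Set X} (hs : MeasurableSet s) :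
    ∃ P : H →L[ℂ] H, ∀ ξ, ⟪ξ, P ξ⟫_ℂ = (((vecMeasure π ξ).real s : ℝ) : ℂ) ∧
      ‖P ξ‖ ^ 2 = (vecMeasure π ξ).real s := by
  choose p hp using fun ξ : H => exists_limit π ξ hs
  have hnorm : ∀ ξ, ‖p ξ‖ ^ 2 = (vecMeasure π ξ).real s := fun ξ => by
    obtain ⟨f, hf⟩ := exists_approximates (vecMeasure π ξ) hs
    exact tendsto_nhds_unique ((hp ξ f hf).norm.pow 2) (tendsto_norm_sq_of_approximates π ξ hs hf)
  have hadd : ∀ ξ η, p (ξ + η) = p ξ + p η := fun ξ η => by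
    -- Approximating with respect to the sum of the three measures yields one sequence valid for
    -- `ξ`, `η` and `ξ + η` together.
    obtain ⟨f, hf⟩ := exists_approximates
      (vecMeasure π ξ + vecMeasure π η + vecMeasure π (ξ + η)) hs
    have h1 := hp ξ f (hf.mono (by rw [add_assoc]; exact Measure.le_add_right le_rfl) hs)
    have h2 := hp η f (hf.mono (Measure.le_add_right (Measure.le_add_left le_rfl)) hs)
    have h3 := hp (ξ + η) f (hf.mono (Measure.le_add_left le_rfl) hs)
    refine tendsto_nhds_unique h3 ((h1.add h2).congr fun n => ?_)
    rw [map_add]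
  have hsmul : ∀ (c : ℂ) ξ, p (c • ξ) = c • p ξ := fun c ξ => by
    obtain ⟨f, hf⟩ := exists_approximates
      (vecMeasure π ξ + vecMeasure π (c • ξ)) hs
    have h1 := hp ξ f (hf.mono (Measure.le_add_right le_rfl) hs)
    have h3 := hp (c • ξ) f (hf.mono (Measure.le_add_left le_rfl) hs)
    refine tendsto_nhds_unique h3 ((h1.const_smul c).congr fun n => ?_)
    rw [map_smul]
  refine ⟨LinearMap.mkContinuous ⟨⟨p, hadd⟩, hsmul⟩ 1 fun ξ => ?_, fun ξ => ⟨?_, hnorm ξ⟩⟩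
  · rw [one_mul]
    refine le_of_sq_le_sq ?_ (norm_nonneg _)
    change ‖p ξ‖ ^ 2 ≤ _
    rw [hnorm, ← vecMeasure_univ π ξ]
    exact measureReal_mono (Set.subset_univ _)
  · obtain ⟨f, hf⟩ := exists_approximates (vecMeasure π ξ) hs
    exact tendsto_nhds_unique (tendsto_const_nhds.inner (hp ξ f hf))
      (tendsto_inner_of_approximates π ξ hs hf)

end SpectralRep

/-! ### Projection-valued measures from families of scalar measures -/

namespace ProjectionValuedMeasure

variable {H : Type*} [NormedAddCommGroup H] [InnerProductSpace ℂ H] [CompleteSpace H]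

theorem inner_proj_eq (E : ProjectionValuedMeasure H) (ξ : H) {s : Set ℝ} (hs : MeasurableSet s) :
    ⟪ξ, E.proj s ξ⟫_ℂ = ((‖E.proj s ξ‖ ^ 2 : ℝ) : ℂ) := by
  have hP := E.isStarProjection s hs
  have h1 : E.proj s (E.proj s ξ) = E.proj s ξ :=
    DFunLike.congr_fun hP.isIdempotentElem.eq ξ
  conv_lhs => rw [← h1]
  rw [← ContinuousLinearMap.adjoint_inner_left, hP.isSelfAdjoint.adjoint_eq,
    inner_self_eq_norm_sq_to_K]
  norm_cast

theorem measure_apply (E : ProjectionValuedMeasure H) (ξ : H) {s : Set ℝ}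
    (hs : MeasurableSet s) :
    E.measure ξ s = ENNReal.ofReal (‖E.proj s ξ‖ ^ 2) := by
  rw [measure, Measure.ofMeasurable_apply _ hs, inner_proj_eq E ξ hs, Complex.ofReal_re]

theorem measure_univ (E : ProjectionValuedMeasure H) (ξ : H) :
    E.measure ξ Set.univ = ENNReal.ofReal (‖ξ‖ ^ 2) := by
  rw [measure_apply E ξ MeasurableSet.univ, E.proj_univ, one_apply_eq_self]

instance (E : ProjectionValuedMeasure H) (ξ : H) : IsFiniteMeasure (E.measure ξ) :=
  ⟨by rw [measure_univ]; exact ENNReal.ofReal_lt_top⟩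

theorem measureReal_apply (E : ProjectionValuedMeasure H) (ξ : H) {s : Set ℝ}
    (hs : MeasurableSet s) : (E.measure ξ).real s = ‖E.proj s ξ‖ ^ 2 := by
  rw [measureReal_def, measure_apply E ξ hs, ENNReal.toReal_ofReal (by positivity)]

/-- A family of finite measures on the real line, given by bounded operators in the sense of
quadratic forms, comes from a projection-valued measure. -/
theorem exists_of_measures (ν : H → Measure ℝ) [∀ ξ, IsFiniteMeasure (ν ξ)]
    (huniv : ∀ ξ, (ν ξ).real Set.univ = ‖ξ‖ ^ 2)
    (hP : ∀ s, MeasurableSet s → ∃ P : H →L[ℂ] H, ∀ ξ,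
      ⟪ξ, P ξ⟫_ℂ = (((ν ξ).real s : ℝ) : ℂ) ∧ ‖P ξ‖ ^ 2 = (ν ξ).real s) :
    ∃ E : ProjectionValuedMeasure H, ∀ ξ, E.measure ξ = ν ξ := by
  classical
  choose! P hP using hP
  have hinner := fun s hs ξ => (hP s hs ξ).1
  have hnorm := fun s hs ξ => (hP s hs ξ).2
  have hadd : ∀ s t, MeasurableSet s → MeasurableSet t → Disjoint s t →
      P (s ∪ t) = P s + P t := fun s t hs ht hd => by
    refine SpectralRep.clm_ext_inner fun ξ => ?_
    rw [add_apply, inner_add_right, hinner _ (hs.union ht), hinner _ hs,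
      hinner _ ht, measureReal_union hd ht, Complex.ofReal_add]
  have hempty : P ∅ = 0 := by
    refine SpectralRep.clm_ext_inner fun ξ => ?_
    rw [hinner _ MeasurableSet.empty]
    simp
  let E : ProjectionValuedMeasure H :=
    { proj := P
      isStarProjection s hs := by
        -- This single identity gives both self-adjointness and idempotence.
        have h : star (P s) * P s = P s := by
          refine SpectralRep.clm_ext_inner fun ξ => ?_
          rw [mul_apply_eq_comp, ContinuousLinearMap.star_eq_adjoint,
            ContinuousLinearMap.adjoint_inner_right, hinner s hs, inner_self_eq_norm_sq_to_K,
            ← hnorm s hs]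
          norm_cast
        have hsa : IsSelfAdjoint (P s) := by
          rw [← h]; exact IsSelfAdjoint.star_mul_self _
        refine ⟨?_, hsa⟩
        rw [hsa.star_eq] at h
        exact h
      proj_univ := by
        refine SpectralRep.clm_ext_inner fun ξ => ?_
        rw [hinner _ MeasurableSet.univ, huniv, one_apply_eq_self,
          inner_self_eq_norm_sq_to_K]
        norm_cast
      hasSum_iUnion s hs hd ξ := by
        have hU : MeasurableSet (⋃ n, s n) := MeasurableSet.iUnion hs
        have hF : ∀ F : Finset ℕ, MeasurableSet (⋃ n ∈ F, s n) := fun F =>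
          F.measurableSet_biUnion fun n _ => hs n
        have hPF : ∀ F : Finset ℕ, P (⋃ n ∈ F, s n) = ∑ n ∈ F, P (s n) := fun F => by
          induction F using Finset.induction_on with
          | empty => simpa using hempty
          | insert a F ha ih =>
            rw [Finset.set_biUnion_insert, hadd _ _ (hs a) (hF F), Finset.sum_insert ha, ih]
            refine Set.disjoint_iUnion₂_right.2 fun n hn => hd ?_
            rintro rfl
            exact ha hn
        have hsum : HasSum (fun n => (ν ξ).real (s n)) ((ν ξ).real (⋃ n, s n)) := by
          rw [measureReal_def, measure_iUnion (fun m n hmn => hd hmn) hs,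
            ENNReal.tsum_toReal_eq fun n => measure_ne_top _ _]
          refine ENNReal.hasSum_toReal ?_
          rw [← measure_iUnion (fun m n hmn => hd hmn) hs]
          exact measure_ne_top _ _
        -- The error of a partial sum is minus the projection of the remaining set, so strong
        -- countable additivity reduces to that of the scalar measure.
        have hdiff : ∀ F : Finset ℕ, ‖(∑ n ∈ F, P (s n) ξ) - P (⋃ n, s n) ξ‖ ^ 2 =
            (ν ξ).real (⋃ n, s n) - ∑ n ∈ F, (ν ξ).real (s n) := fun F => by
          have hsub : (⋃ n ∈ F, s n) ⊆ ⋃ n, s n := Set.iUnion₂_subset_iUnion _ _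
          have hm : MeasurableSet ((⋃ n, s n) \ ⋃ n ∈ F, s n) := hU.diff (hF F)
          have h1 := hadd _ _ (hF F) hm Set.disjoint_sdiff_right
          rw [Set.union_sdiff_cancel hsub, hPF] at h1
          have h2 : (∑ n ∈ F, P (s n) ξ) - P (⋃ n, s n) ξ = -P ((⋃ n, s n) \ ⋃ n ∈ F, s n) ξ := by
            rw [h1, add_apply, sum_apply]
            abel
          rw [h2, norm_neg, hnorm _ hm, measureReal_sdiff hsub (hF F)]
          congr 1
          exact measureReal_biUnion_finset (fun m _ n _ hmn => hd hmn) (fun n _ => hs n)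
        have h0 : Tendsto (fun F : Finset ℕ => ‖(∑ n ∈ F, P (s n) ξ) - P (⋃ n, s n) ξ‖ ^ 2)
            atTop (𝓝 0) := by
          simp_rw [hdiff]
          have := (tendsto_const_nhds (x := (ν ξ).real (⋃ n, s n))).sub hsum
          simpa using this
        rw [HasSum, SummationFilter.unconditional_filter, tendsto_iff_norm_sub_tendsto_zero]
        simpa using h0.sqrt }
  refine ⟨E, fun ξ => Measure.ext fun s hs => ?_⟩
  rw [measure_apply E ξ hs]
  change ENNReal.ofReal (‖P s ξ‖ ^ 2) = _
  rw [hnorm s hs, ofReal_measureReal]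

/-- The push-forward to the real line of the spectral measures of a representation of `C(X, ℂ)`. -/
theorem exists_of_representation {X : Type*} [TopologicalSpace X] [T2Space X] [CompactSpace X]
    [TopologicalSpace.PseudoMetrizableSpace X]
    [MeasurableSpace X] [BorelSpace X]
    (π : C(X, ℂ) →⋆ₐ[ℂ] (H →L[ℂ] H)) {g : X → ℝ} (hg : Measurable g) :
    ∃ E : ProjectionValuedMeasure H, ∀ ξ,
      E.measure ξ = (SpectralRep.vecMeasure π ξ).map g := by
  refine exists_of_measures _ (fun ξ => ?_) fun s hs => ?_
  · rw [map_measureReal_apply hg MeasurableSet.univ, Set.preimage_univ,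
      SpectralRep.vecMeasure_univ]
  · obtain ⟨P, hP⟩ := SpectralRep.exists_proj π (hg hs)
    refine ⟨P, fun ξ => ?_⟩
    rw [map_measureReal_apply hg hs]
    exact hP ξ

end ProjectionValuedMeasure

/-! ### The resolvent of a self-adjoint operator -/

namespace SelfAdjointResolvent

variable {H : Type*} [NormedAddCommGroup H] [InnerProductSpace ℂ H] [CompleteSpace H]
variable {D : H →ₗ.[ℂ] H}

theorem inner_apply_left (hD : IsSelfAdjoint D) (x y : D.domain) :
    ⟪D x, (y : H)⟫_ℂ = ⟪(x : H), D y⟫_ℂ := by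
  have h := LinearPMap.adjoint_isFormalAdjoint hD.dense_domain
  rw [LinearPMap.isSelfAdjoint_def.1 hD] at h
  exact h x y

theorem mem_domain_of_inner (hD : IsSelfAdjoint D) {y w : H}
    (h : ∀ x : D.domain, ⟪w, (x : H)⟫_ℂ = ⟪y, D x⟫_ℂ) : ∃ hy : y ∈ D.domain, D ⟨y, hy⟩ = w := by
  have hD' := LinearPMap.isSelfAdjoint_def.1 hD
  have hy : y ∈ D.adjoint.domain := LinearPMap.mem_adjoint_domain_of_exists y ⟨w, h⟩
  have hw := LinearPMap.adjoint_apply_eq hD.dense_domain ⟨y, hy⟩ h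
  rw [← hD']
  exact ⟨hy, hw⟩

/-- The operator `D + c`. -/
def addScalar (D : H →ₗ.[ℂ] H) (c : ℂ) : D.domain →ₗ[ℂ] H :=
  D.toFun + c • D.domain.subtype

theorem addScalar_apply (c : ℂ) (x : D.domain) : addScalar D c x = D x + c • (x : H) := rfl

theorem inner_self_im (hD : IsSelfAdjoint D) (x : D.domain) : (⟪(x : H), D x⟫_ℂ).im = 0 := by
  have h := inner_apply_left hD x x
  rw [← inner_conj_symm] at h
  exact Complex.conj_eq_iff_im.1 h

variable {c : ℂ}

/-- For `c = ±i` the cross term is the real part of an imaginary number times the real number `⟨x, D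
x⟩`, so it vanishes. -/
theorem norm_addScalar_sq (hD : IsSelfAdjoint D) (hre : c.re = 0) (hc : ‖c‖ = 1) (x : D.domain) :
    ‖addScalar D c x‖ ^ 2 = ‖D x‖ ^ 2 + ‖(x : H)‖ ^ 2 := by
  rw [addScalar_apply, @norm_add_sq ℂ, inner_smul_right, norm_smul, hc, one_mul,
    inner_apply_left hD]
  have : RCLike.re (c * ⟪(x : H), D x⟫_ℂ) = 0 := by
    change (c * ⟪(x : H), D x⟫_ℂ).re = 0
    rw [Complex.mul_re, hre, inner_self_im hD]
    simp
  rw [this]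
  ring

theorem norm_le_addScalar (hD : IsSelfAdjoint D) (hre : c.re = 0) (hc : ‖c‖ = 1) (x : D.domain) :
    ‖(x : H)‖ ≤ ‖addScalar D c x‖ := by
  refine le_of_sq_le_sq ?_ (norm_nonneg _)
  rw [norm_addScalar_sq hD hre hc]
  nlinarith [sq_nonneg ‖D x‖]

/-- `D + c` is bounded below, so preimages of a convergent sequence are Cauchy; closedness of the
graph of `D` puts their limit in the domain. -/
theorem isClosed_range_addScalar (hD : IsSelfAdjoint D) (hre : c.re = 0) (hc : ‖c‖ = 1) :
    IsClosed ((LinearMap.range (addScalar D c) : Submodule ℂ H) : Set H) := by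
  refine isClosed_of_closure_subset fun y hy => ?_
  obtain ⟨u, hu, hlim⟩ := mem_closure_iff_seq_limit.1 hy
  choose x hx using hu
  have hcau := hlim.cauchySeq
  have hcx : CauchySeq fun n => (x n : H) := by
    rw [Metric.cauchySeq_iff] at hcau ⊢
    intro ε hε
    obtain ⟨N, hN⟩ := hcau ε hε
    refine ⟨N, fun m hm n hn => lt_of_le_of_lt ?_ (hN m hm n hn)⟩
    rw [dist_eq_norm, dist_eq_norm, ← hx, ← hx, ← map_sub]
    exact norm_le_addScalar hD hre hc (x m - x n)
  obtain ⟨a, ha⟩ := cauchySeq_tendsto_of_complete hcx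
  have hDx : Tendsto (fun n => D (x n)) atTop (𝓝 (y - c • a)) := by
    refine (hlim.sub (ha.const_smul c)).congr fun n => ?_
    rw [← hx, addScalar_apply, add_sub_cancel_right]
  have hmem : (a, y - c • a) ∈ D.graph := by
    have hcl : IsClosed (D.graph : Set (H × H)) := hD.isClosed
    refine hcl.mem_of_tendsto (ha.prodMk_nhds hDx) (Eventually.of_forall fun n => ?_)
    exact LinearPMap.mem_graph D (x n)
  obtain ⟨b, hb1, hb2⟩ := (LinearPMap.mem_graph_iff D).1 hmem
  refine ⟨b, ?_⟩
  rw [addScalar_apply, hb1, hb2]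
  simp

/-- The range is closed, so it suffices that its orthogonal complement vanishes. A vector `y`
orthogonal to it satisfies `D y = c y` by self-adjointness; then `c ‖y‖² = ⟨y, D y⟩` is real with
`c` imaginary, so `y = 0`. -/
theorem surjective_addScalar (hD : IsSelfAdjoint D) (hre : c.re = 0) (hc : ‖c‖ = 1) :
    Function.Surjective (addScalar D c) := by
  rw [← LinearMap.range_eq_top]
  have hcl := isClosed_range_addScalar hD hre hc
  rw [← hcl.submodule_topologicalClosure_eq, Submodule.topologicalClosure_eq_top_iff,
    Submodule.eq_bot_iff]
  intro y hy
  rw [Submodule.mem_orthogonal'] at hy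
  have hconj : (starRingEnd ℂ) c = -c := by
    apply Complex.ext <;> simp [hre]
  obtain ⟨hmem, hDy⟩ := mem_domain_of_inner hD (y := y) (w := c • y) fun x => by
    have h := hy _ ⟨x, rfl⟩
    rw [addScalar_apply, inner_add_right, inner_smul_right] at h
    rw [inner_smul_left, hconj]
    linear_combination -h
  have him := inner_self_im hD ⟨y, hmem⟩
  rw [hDy] at him
  simp only [inner_smul_right, inner_self_eq_norm_sq_to_K] at him
  have h2 : (c * ((‖y‖ : ℂ)) ^ 2).im = 0 := him
  rw [← Complex.ofReal_pow, Complex.im_mul_ofReal] at h2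
  have hcim : c.im ≠ 0 := by
    intro h0
    have : c = 0 := Complex.ext hre h0
    simp [this] at hc
  simpa [hcim] using h2

theorem exists_resolvent (hD : IsSelfAdjoint D) (hre : c.re = 0) (hc : ‖c‖ = 1) :
    ∃ R : H →L[ℂ] H, (∀ x : D.domain, R (D x + c • (x : H)) = x) ∧
      ∀ y, ∃ h : R y ∈ D.domain, D ⟨R y, h⟩ = y - c • R y := by
  have hinj : Function.Injective (addScalar D c) := by
    rw [injective_iff_map_eq_zero]
    intro x hx
    have := norm_le_addScalar hD hre hc x
    rw [hx, norm_zero, norm_le_zero_iff] at this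
    exact Subtype.ext this
  let e := LinearEquiv.ofBijective (addScalar D c) ⟨hinj, surjective_addScalar hD hre hc⟩
  have he : ∀ y, addScalar D c (e.symm y) = y := e.apply_symm_apply
  refine ⟨(D.domain.subtype ∘ₗ e.symm.toLinearMap).mkContinuous 1 fun y => ?_, fun x => ?_,
    fun y => ⟨(e.symm y).2, ?_⟩⟩
  · have := norm_le_addScalar hD hre hc (e.symm y)
    rw [he] at this
    simpa using this
  · have : e.symm (addScalar D c x) = x := e.symm_apply_apply x
    exact congrArg Subtype.val this
  · have := he y
    rw [addScalar_apply] at this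
    exact eq_sub_of_add_eq this

/-- The resolvent `R = (D + i)⁻¹` is a normal operator. -/
theorem exists_normal_resolvent (hD : IsSelfAdjoint D) :
    ∃ R : H →L[ℂ] H, IsStarNormal R ∧ star R - R = (2 * Complex.I) • (star R * R) ∧
      (∀ x : D.domain, R (D x + Complex.I • (x : H)) = x) ∧
      ∀ y, ∃ h : R y ∈ D.domain, D ⟨R y, h⟩ = y - Complex.I • R y := by
  obtain ⟨R, hR1, hR2⟩ := exists_resolvent hD (c := Complex.I) (by simp) (by simp)
  obtain ⟨S, hS1, hS2⟩ := exists_resolvent hD (c := -Complex.I) (by simp) (by simp)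
  have hstar : star R = S := by
    symm
    rw [ContinuousLinearMap.star_eq_adjoint, ContinuousLinearMap.eq_adjoint_iff]
    intro x y
    obtain ⟨h1, h2⟩ := hS2 x
    obtain ⟨h3, h4⟩ := hR2 y
    have := inner_apply_left hD ⟨S x, h1⟩ ⟨R y, h3⟩
    rw [h2, h4] at this
    simp only [neg_smul, sub_neg_eq_add, inner_add_left, inner_sub_right, inner_smul_left,
      inner_smul_right, Complex.conj_I] at this
    linear_combination -this
  -- The resolvent identity in both orders; comparing the two shows that `R` commutes with its
  -- adjoint.
  have h1 : S - R = (2 * Complex.I) • (S * R) := by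
    ext y
    obtain ⟨h, hy⟩ := hR2 y
    have := hS1 ⟨R y, h⟩
    rw [hy] at this
    simp only [neg_smul, map_add, map_sub, map_neg, map_smul] at this
    change S y - R y = (2 * Complex.I) • S (R y)
    linear_combination (norm := module) (1 : ℂ) • this
  have h2 : S - R = (2 * Complex.I) • (R * S) := by
    ext y
    obtain ⟨h, hy⟩ := hS2 y
    have := hR1 ⟨S y, h⟩
    rw [hy] at this
    simp only [neg_smul, map_add, map_sub, map_neg, map_smul] at this
    change S y - R y = (2 * Complex.I) • R (S y)
    linear_combination (norm := module) (-1 : ℂ) • this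
  refine ⟨R, ⟨?_⟩, hstar ▸ h1, hR1, hR2⟩
  rw [hstar]
  exact smul_right_injective _ (by simp) (h1.symm.trans h2)

end SelfAdjointResolvent

/-! ### The spectral theorem for self-adjoint operators -/

namespace SelfAdjointResolvent

open SpectralRep

variable {H : Type*} [NormedAddCommGroup H] [InnerProductSpace ℂ H] [CompleteSpace H]
variable {D : H →ₗ.[ℂ] H}

/-- The coordinate function on the spectrum. -/
def coord (R : H →L[ℂ] H) : C(spectrum ℂ R, ℂ) := ⟨fun z => (z : ℂ), continuous_subtype_val⟩

@[simp] theorem coord_apply (R : H →L[ℂ] H) (z : spectrum ℂ R) : coord R z = (z : ℂ) := rfl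

/-- The real part of the inverse on the spectrum: the position `x` when `z = (x + i)⁻¹`. -/
noncomputable def position (R : H →L[ℂ] H) (z : spectrum ℂ R) : ℝ := ((z : ℂ)⁻¹).re

theorem measurable_position (R : H →L[ℂ] H) : Measurable (position R) :=
  Complex.measurable_re.comp measurable_subtype_coe.inv

variable {R : H →L[ℂ] H}

section pointwise

variable (hR : IsStarNormal R) (hrel : star R - R = (2 * Complex.I) • (star R * R))

/-- The functional calculus of a normal operator. -/
noncomputable def calculus : C(spectrum ℂ R, ℂ) →⋆ₐ[ℂ] (H →L[ℂ] H) := cfcHom hR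

theorem calculus_coord : calculus hR (coord R) = R := cfcHom_id hR

include hR hrel in
-- The relation between `R` and `star R` passes to the coordinate function by injectivity of the
-- calculus. It places the spectrum on the circle of the points `(x + i)⁻¹`, `x` real, completed by
-- `0`, which corresponds to `x = ∞`.
theorem im_eq_neg_normSq (z : spectrum ℂ R) : (z : ℂ).im = -‖(z : ℂ)‖ ^ 2 := by
  have h : star (coord R) - coord R = (2 * Complex.I) • (star (coord R) * coord R) := by
    apply cfcHom_injective hR
    change calculus hR _ = calculus hR _
    rw [map_sub, map_smul, map_mul, map_star, calculus_coord, hrel]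
  have hz := DFunLike.congr_fun h z
  simp only [ContinuousMap.sub_apply, ContinuousMap.star_apply, ContinuousMap.smul_apply,
    ContinuousMap.mul_apply, coord_apply, Complex.star_def, Complex.conj_mul', smul_eq_mul] at hz
  have := congrArg Complex.im hz
  simp only [Complex.sub_im, Complex.conj_im, ← Complex.ofReal_pow, Complex.im_mul_ofReal] at this
  simp at this
  linarith

include hR hrel in
theorem norm_coord_le_one (z : spectrum ℂ R) : ‖(z : ℂ)‖ ≤ 1 := by
  have h := im_eq_neg_normSq hR hrel z
  have h2 := Complex.abs_im_le_norm (z : ℂ)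
  rw [h, abs_neg, abs_of_nonneg (by positivity)] at h2
  by_contra hlt
  push Not at hlt
  nlinarith

/-- At `z = 0` both sides vanish, because `0⁻¹ = 0` makes the position `0` there. -/
theorem normSq_mul_position (z : spectrum ℂ R) :
    ‖(z : ℂ)‖ ^ 2 * position R z = (z : ℂ).re := by
  rw [position, Complex.inv_re, ← Complex.normSq_eq_norm_sq]
  by_cases hz : (z : ℂ) = 0
  · simp [hz]
  · have := Complex.normSq_pos.2 hz
    field_simp

include hR hrel in
theorem norm_inv_sq_eq (z : spectrum ℂ R) (hz : (z : ℂ) ≠ 0) :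
    ‖(z : ℂ)⁻¹‖ ^ 2 = position R z ^ 2 + 1 := by
  have h1 : ((z : ℂ)⁻¹).im = 1 := by
    have := Complex.normSq_pos.2 hz
    rw [Complex.inv_im, im_eq_neg_normSq hR hrel, neg_neg, ← Complex.normSq_eq_norm_sq,
      div_self this.ne']
  rw [← Complex.normSq_eq_norm_sq, Complex.normSq_apply, h1, position]
  ring

include hR hrel in
theorem norm_inv_sq_le (z : spectrum ℂ R) : ‖(z : ℂ)⁻¹‖ ^ 2 ≤ position R z ^ 2 + 1 := by
  by_cases hz : (z : ℂ) = 0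
  · rw [hz]
    rw [inv_zero, norm_zero, zero_pow two_ne_zero]
    positivity
  · exact (norm_inv_sq_eq hR hrel z hz).le

include hR hrel in
theorem normSq_mul_position_sq_le (z : spectrum ℂ R) :
    ‖(z : ℂ)‖ ^ 2 * position R z ^ 2 ≤ 1 := by
  by_cases hz : (z : ℂ) = 0
  · simp [hz]
  · have h1 := norm_inv_sq_eq hR hrel z hz
    rw [norm_inv, inv_pow] at h1
    have h2 : 0 < ‖(z : ℂ)‖ ^ 2 := pow_pos (norm_pos_iff.2 hz) 2
    have h3 : ‖(z : ℂ)‖ ^ 2 * (position R z ^ 2 + 1) = 1 := by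
      rw [← h1, mul_inv_cancel₀ h2.ne']
    linarith

end pointwise

variable (hR : IsStarNormal R)

/-- The domain of `D` is the range of `R`; this change of density reduces integrals for `R ζ` to
integrals for `ζ`, where the factor `‖z‖²` tames the unbounded position. -/
theorem vecMeasure_map_coord (ζ : H) :
    vecMeasure (calculus hR) (R ζ) =
      (vecMeasure (calculus hR) ζ).withDensity fun z => (‖(z : ℂ)‖₊ ^ 2 : NNReal) := by
  have hm : Measurable fun z : spectrum ℂ R => (‖(z : ℂ)‖₊ ^ 2 : NNReal) := by fun_prop
  have hfin : IsFiniteMeasure ((vecMeasure (calculus hR) ζ).withDensity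
      fun z => ((‖(z : ℂ)‖₊ ^ 2 : NNReal) : ENNReal)) := by
    have h := isFiniteMeasure_withDensity_ofReal (f := fun z : spectrum ℂ R => ‖(z : ℂ)‖ ^ 2)
      (integrable_vecMeasure (calculus hR) ζ (by fun_prop)).2
    convert h using 3 with z
    rw [← ENNReal.ofReal_coe_nnreal]
    simp
  refine ext_of_forall_integral_eq_of_IsFiniteMeasure fun f => ?_
  rw [integral_withDensity_eq_integral_smul hm]
  have h1 := integral_vecMeasure (calculus hR) (R ζ) (complexify f.toContinuousMap)
  have h2 := integral_vecMeasure (calculus hR) ζ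
    (star (coord R) * (complexify f.toContinuousMap * coord R))
  rw [← inner_map_mul, map_mul, calculus_coord, mul_apply_eq_comp, ← h1] at h2
  have h3 : ∀ z, (star (coord R) * (complexify f.toContinuousMap * coord R)) z =
      ((‖(z : ℂ)‖ ^ 2 * f z : ℝ) : ℂ) := fun z => by
    simp only [ContinuousMap.mul_apply, ContinuousMap.star_apply, coord_apply, complexify_apply,
      Complex.star_def]
    push_cast
    rw [← Complex.conj_mul']
    simp only [BoundedContinuousFunction.coe_toContinuousMap]
    ring
  simp_rw [h3] at h2
  simp only [complexify_apply, BoundedContinuousFunction.coe_toContinuousMap] at h2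
  rw [integral_complex_ofReal, integral_complex_ofReal] at h2
  exact (Complex.ofReal_injective h2).symm

theorem integral_vecMeasure_map_coord (ζ : H) (f : spectrum ℂ R → ℝ) :
    ∫ z : spectrum ℂ R, f z ∂(vecMeasure (calculus hR) (R ζ)) =
      ∫ z : spectrum ℂ R, ‖(z : ℂ)‖ ^ 2 * f z ∂(vecMeasure (calculus hR) ζ) := by
  rw [vecMeasure_map_coord, integral_withDensity_eq_integral_smul (by fun_prop)]
  rfl

theorem integrable_vecMeasure_map_coord (ζ : H) (f : spectrum ℂ R → ℝ) :
    Integrable f (vecMeasure (calculus hR) (R ζ)) ↔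
      Integrable (fun z : spectrum ℂ R => ‖(z : ℂ)‖ ^ 2 * f z) (vecMeasure (calculus hR) ζ) := by
  rw [vecMeasure_map_coord, integrable_withDensity_iff_integrable_smul (by fun_prop)]
  rfl

variable (hrel : star R - R = (2 * Complex.I) • (star R * R))

include hrel in
-- The limit vector `v` attached to the set `{0}` is killed by `R`, since `z` times the indicator of
-- `{0}` is zero. Injectivity of `R` gives `v = 0`, and `‖v‖²` is the mass: there is no mass at
-- infinite position.
theorem vecMeasure_zero (hinj : ∀ y, R y = 0 → y = 0) (ξ : H) :
    (vecMeasure (calculus hR) ξ) {z : spectrum ℂ R | (z : ℂ) = 0} = 0 := by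
  set s : Set (spectrum ℂ R) := {z | (z : ℂ) = 0} with hs
  have hsm : MeasurableSet s := measurable_subtype_coe (measurableSet_singleton (0 : ℂ))
  obtain ⟨v, hv⟩ := exists_limit (calculus hR) ξ hsm
  obtain ⟨f, hf⟩ := exists_approximates (vecMeasure (calculus hR) ξ) hsm
  have hlim := hv f hf
  have hRv : Tendsto (fun n => R (calculus hR (complexify (f n)) ξ)) atTop (𝓝 (R v)) :=
    (R.continuous.tendsto v).comp hlim
  have h0 : Tendsto (fun n => ‖R (calculus hR (complexify (f n)) ξ)‖ ^ 2) atTop (𝓝 0) := by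
    refine squeeze_zero (fun n => by positivity) (fun n => ?_) hf.2
    have : R (calculus hR (complexify (f n)) ξ) =
        calculus hR (coord R * complexify (f n)) ξ := by
      rw [map_mul, calculus_coord, mul_apply_eq_comp]
    rw [this, norm_map_sq]
    refine integral_mono (integrable_vecMeasure _ ξ (by fun_prop))
      (integrable_abs_sub_indicator _ hsm (f n)) fun z => ?_
    simp only [ContinuousMap.mul_apply, coord_apply, complexify_apply, norm_mul,
      Complex.norm_real, Real.norm_eq_abs]
    by_cases hz : z ∈ s
    · have : (z : ℂ) = 0 := hz
      rw [this]
      simp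
    · rw [Set.indicator_of_notMem hz, sub_zero, abs_of_nonneg (hf.1 n z).1]
      have h1 := norm_coord_le_one hR hrel z
      have h3 := hf.1 n z
      have h4 : ‖(z : ℂ)‖ * f n z ≤ f n z := mul_le_of_le_one_left h3.1 h1
      have h5 : 0 ≤ ‖(z : ℂ)‖ * f n z := mul_nonneg (norm_nonneg _) h3.1
      nlinarith [h3.2]
  have hv0 : v = 0 := by
    apply hinj
    have := tendsto_nhds_unique (hRv.norm.pow 2) h0
    simpa using this
  have := tendsto_nhds_unique (hlim.norm.pow 2)
    (tendsto_norm_sq_of_approximates (calculus hR) ξ hsm hf)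
  rw [hv0] at this
  simpa [measureReal_eq_zero_iff] using this.symm

include hrel in
-- The preimage is `z⁻¹` applied to `ξ`. This function is square integrable because `‖z⁻¹‖² ≤
-- position² + 1`, but it is unbounded, so it is reached as an `L²` limit of continuous functions.
theorem mem_range_of_integrable (hinj : ∀ y, R y = 0 → y = 0) (ξ : H)
    (hint : Integrable (fun z : spectrum ℂ R => position R z ^ 2) (vecMeasure (calculus hR) ξ)) :
    ∃ ζ, R ζ = ξ := by
  set ν := vecMeasure (calculus hR) ξ with hν
  have hne : ∀ᵐ z : spectrum ℂ R ∂ν, (z : ℂ) ≠ 0 := by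
    rw [ae_iff]
    simpa using vecMeasure_zero hR hrel hinj ξ
  have hpos : ∀ (n : ℕ) (z : spectrum ℂ R), 0 < ‖(z : ℂ)‖ ^ 2 + 1 / ((n : ℝ) + 1) := fun n z => by
    positivity
  -- Continuous regularisations of `z⁻¹ = conj z / ‖z‖²`, converging to it off `z = 0` with `‖z * f
  -- n z - 1‖ ≤ 1` throughout.
  let f : ℕ → C(spectrum ℂ R, ℂ) := fun n =>
    ⟨fun z => (starRingEnd ℂ) z * ((‖(z : ℂ)‖ ^ 2 + 1 / ((n : ℝ) + 1))⁻¹ : ℝ), by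
      refine Continuous.mul (by fun_prop) (Complex.continuous_ofReal.comp ?_)
      exact Continuous.inv₀ (by fun_prop) fun z => (hpos n z).ne'⟩
  have hfz : ∀ (n : ℕ) (z : spectrum ℂ R), (z : ℂ) * f n z =
      ((‖(z : ℂ)‖ ^ 2 * (‖(z : ℂ)‖ ^ 2 + 1 / ((n : ℝ) + 1))⁻¹ : ℝ) : ℂ) := fun n z => by
    simp only [f, ContinuousMap.coe_mk]
    rw [← mul_assoc, Complex.mul_conj']
    push_cast
    ring
  have hbd : ∀ (n : ℕ) (z : spectrum ℂ R), ‖(z : ℂ) * f n z - 1‖ ≤ 1 := fun n z => by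
    rw [hfz, ← Complex.ofReal_one, ← Complex.ofReal_sub, Complex.norm_real, Real.norm_eq_abs,
      abs_le]
    have h1 : 0 ≤ ‖(z : ℂ)‖ ^ 2 * (‖(z : ℂ)‖ ^ 2 + 1 / ((n : ℝ) + 1))⁻¹ :=
      mul_nonneg (by positivity) (inv_nonneg.2 (hpos n z).le)
    have h2 : ‖(z : ℂ)‖ ^ 2 * (‖(z : ℂ)‖ ^ 2 + 1 / ((n : ℝ) + 1))⁻¹ ≤ 1 := by
      rw [← div_eq_mul_inv, div_le_one (hpos n z)]
      have : (0 : ℝ) ≤ 1 / ((n : ℝ) + 1) := by positivity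
      linarith
    constructor <;> linarith
  have hlim : ∀ z : spectrum ℂ R, (z : ℂ) ≠ 0 →
      Tendsto (fun n => (z : ℂ) * f n z) atTop (𝓝 1) := fun z hz => by
    have h1 : Tendsto (fun n : ℕ => ‖(z : ℂ)‖ ^ 2 * (‖(z : ℂ)‖ ^ 2 + 1 / ((n : ℝ) + 1))⁻¹) atTop
        (𝓝 1) := by
      have h2 : ‖(z : ℂ)‖ ^ 2 ≠ 0 := by positivity
      have h3 := (tendsto_const_nhds (x := ‖(z : ℂ)‖ ^ 2)).add
        tendsto_one_div_add_atTop_nhds_zero_nat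
      rw [add_zero] at h3
      have h4 := (h3.inv₀ h2).const_mul (‖(z : ℂ)‖ ^ 2)
      rwa [mul_inv_cancel₀ h2] at h4
    have := (Complex.continuous_ofReal.tendsto _).comp h1
    rw [Complex.ofReal_one] at this
    exact this.congr fun n => (hfz n z).symm
  have hlim' : ∀ z : spectrum ℂ R, (z : ℂ) ≠ 0 →
      Tendsto (fun n => f n z) atTop (𝓝 (z : ℂ)⁻¹) := fun z hz => by
    have := (hlim z hz).const_mul (z : ℂ)⁻¹
    simpa [inv_mul_cancel_left₀ hz] using this
  have hminv : Measurable fun z : spectrum ℂ R => (z : ℂ)⁻¹ := measurable_subtype_coe.inv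
  have hbd' : ∀ (n : ℕ) (z : spectrum ℂ R), ‖f n z - (z : ℂ)⁻¹‖ ^ 2 ≤ position R z ^ 2 + 1 := fun n z => by
    refine le_trans ?_ (norm_inv_sq_le hR hrel z)
    by_cases hz : (z : ℂ) = 0
    · simp [f, hz]
    · have : f n z - (z : ℂ)⁻¹ = (z : ℂ)⁻¹ * ((z : ℂ) * f n z - 1) := by
        field_simp
      rw [this, norm_mul]
      gcongr
      exact mul_le_of_le_one_right (norm_nonneg _) (hbd n z)
  have hdom : Integrable (fun z : spectrum ℂ R => position R z ^ 2 + 1) ν := hint.add (integrable_const 1)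
  have hmeas : ∀ n, Measurable fun z : spectrum ℂ R => ‖f n z - (z : ℂ)⁻¹‖ ^ 2 := fun n =>
    (((f n).continuous.measurable.sub hminv).norm).pow_const 2
  have hconv : Tendsto (fun n => ∫ z : spectrum ℂ R, ‖f n z - (z : ℂ)⁻¹‖ ^ 2 ∂ν) atTop (𝓝 0) := by
    have := tendsto_integral_of_dominated_convergence (μ := ν)
      (F := fun n (z : spectrum ℂ R) => ‖f n z - (z : ℂ)⁻¹‖ ^ 2) (f := fun _ => 0)
      (fun z : spectrum ℂ R => position R z ^ 2 + 1) (fun n => (hmeas n).aestronglyMeasurable) hdom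
      (fun n => ae_of_all _ fun z => by
        rw [Real.norm_eq_abs, abs_of_nonneg (by positivity)]
        exact hbd' n z)
      (by
        filter_upwards [hne] with z hz
        have := (((hlim' z hz).sub_const (z : ℂ)⁻¹).norm).pow 2
        simpa using this)
    simpa using this
  have hi : ∀ n, Integrable (fun z : spectrum ℂ R => ‖f n z - (z : ℂ)⁻¹‖ ^ 2) ν := fun n =>
    hdom.mono' (hmeas n).aestronglyMeasurable (ae_of_all _ fun z => by
        rw [Real.norm_eq_abs, abs_of_nonneg (by positivity)]
        exact hbd' n z)
  have hcau : CauchySeq fun n => calculus hR (f n) ξ := by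
    rw [Metric.cauchySeq_iff']
    intro ε hε
    obtain ⟨N, hN⟩ := eventually_atTop.1
      (hconv.eventually (gt_mem_nhds (show 0 < ε ^ 2 / 4 by positivity)))
    refine ⟨N, fun n hn => ?_⟩
    rw [dist_eq_norm]
    refine lt_of_pow_lt_pow_left₀ 2 hε.le ?_
    rw [norm_map_sub_sq]
    have : ∫ z : spectrum ℂ R, ‖f n z - f N z‖ ^ 2 ∂ν ≤ ∫ z : spectrum ℂ R, (2 * ‖f n z - (z : ℂ)⁻¹‖ ^ 2 +
        2 * ‖f N z - (z : ℂ)⁻¹‖ ^ 2) ∂ν := by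
      refine integral_mono (integrable_vecMeasure _ ξ (by fun_prop))
        (((hi n).const_mul 2).add ((hi N).const_mul 2)) fun z => ?_
      have h1 : ‖f n z - f N z‖ ≤ ‖f n z - (z : ℂ)⁻¹‖ + ‖f N z - (z : ℂ)⁻¹‖ := by
        rw [← sub_sub_sub_cancel_right (f n z) (f N z) (z : ℂ)⁻¹]
        exact norm_sub_le _ _
      have h2 := norm_nonneg (f n z - f N z)
      simp only
      nlinarith [sq_nonneg (‖f n z - (z : ℂ)⁻¹‖ - ‖f N z - (z : ℂ)⁻¹‖)]
    rw [integral_add ((hi n).const_mul 2) ((hi N).const_mul 2), integral_const_mul,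
      integral_const_mul] at this
    linarith [hN n hn, hN N le_rfl]
  obtain ⟨ζ, hζ⟩ := cauchySeq_tendsto_of_complete hcau
  refine ⟨ζ, ?_⟩
  have h1 : Tendsto (fun n => R (calculus hR (f n) ξ)) atTop (𝓝 (R ζ)) :=
    (R.continuous.tendsto ζ).comp hζ
  have h2 : Tendsto (fun n => ‖R (calculus hR (f n) ξ) - ξ‖ ^ 2) atTop (𝓝 0) := by
    have h3 : ∀ n, ‖R (calculus hR (f n) ξ) - ξ‖ ^ 2 = ∫ z : spectrum ℂ R, ‖(z : ℂ) * f n z - 1‖ ^ 2 ∂ν :=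
      fun n => by
        have := norm_map_sub_sq (calculus hR) ξ (coord R * f n) 1
        rw [map_mul, calculus_coord, map_one, mul_apply_eq_comp, one_apply_eq_self] at this
        rw [this]
        rfl
    simp_rw [h3]
    have := tendsto_integral_of_dominated_convergence (μ := ν)
      (F := fun n (z : spectrum ℂ R) => ‖(z : ℂ) * f n z - 1‖ ^ 2) (f := fun _ => 0)
      (fun _ => 1) (fun n => Continuous.aestronglyMeasurable (by fun_prop)) (integrable_const 1)
      (fun n => ae_of_all _ fun z => by
        rw [Real.norm_eq_abs, abs_of_nonneg (by positivity)]
        exact pow_le_one₀ (norm_nonneg _) (hbd n z))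
      (by
        filter_upwards [hne] with z hz
        have := (((hlim z hz).sub_const 1).norm).pow 2
        simpa using this)
    simpa using this
  have h3 := tendsto_nhds_unique (((h1.sub_const ξ).norm).pow 2) h2
  rw [sq_eq_zero_iff, norm_eq_zero, sub_eq_zero] at h3
  exact h3

/-- The **spectral theorem** for a (possibly unbounded) self-adjoint operator. -/
theorem exists_represents (hD : IsSelfAdjoint D) :
    ∃ E : ProjectionValuedMeasure H, E.Represents D := by
  obtain ⟨R, hR, hrel, hR1, hR2⟩ := exists_normal_resolvent hD
  have hinj : ∀ y, R y = 0 → y = 0 := fun y hy => by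
    obtain ⟨h, h2⟩ := hR2 y
    have h0 : (⟨R y, h⟩ : D.domain) = 0 := Subtype.ext hy
    rw [h0, hy, LinearPMap.map_zero, smul_zero, sub_zero] at h2
    exact h2.symm
  have hgm := measurable_position R
  obtain ⟨E, hE⟩ := ProjectionValuedMeasure.exists_of_representation (calculus hR) hgm
  refine ⟨E, fun ξ => ?_, fun ξ => ?_⟩
  · rw [hE, integrable_map_measure (by fun_prop) hgm.aemeasurable]
    constructor
    · intro hξ
      obtain ⟨ζ, rfl⟩ : ∃ ζ, R ζ = ξ := ⟨_, hR1 ⟨ξ, hξ⟩⟩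
      rw [integrable_vecMeasure_map_coord]
      refine Integrable.mono' (integrable_const 1) ?_ (ae_of_all _ fun z => ?_)
      · have hm : Measurable fun z : spectrum ℂ R => ‖(z : ℂ)‖ ^ 2 := by fun_prop
        exact (hm.mul (hgm.pow_const 2)).aestronglyMeasurable
      · rw [Real.norm_eq_abs, abs_of_nonneg (by simp only [Function.comp]; positivity)]
        exact normSq_mul_position_sq_le hR hrel z
    · intro hint
      obtain ⟨ζ, rfl⟩ := mem_range_of_integrable hR hrel hinj ξ hint
      exact (hR2 ζ).1
  · obtain ⟨ζ, hζ⟩ : ∃ ζ, R ζ = ξ := ⟨_, hR1 ξ⟩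
    obtain ⟨h1, h2⟩ := hR2 ζ
    have h0 : ξ = ⟨R ζ, h1⟩ := Subtype.ext hζ.symm
    subst h0
    rw [h2, hE, integral_map hgm.aemeasurable (by fun_prop), integral_vecMeasure_map_coord]
    -- Here `D R ζ = (1 - iR) ζ`, so the form is the integral of `conj z * (1 - i z)`, which equals
    -- `Re z` on the circle.
    have h3 := inner_map_mul (calculus hR) (coord R) (1 - Complex.I • coord R) ζ ζ
    rw [map_sub, map_one, map_smul, calculus_coord] at h3
    simp only [sub_apply, one_apply_eq_self, smul_apply] at h3
    rw [h3, ← integral_vecMeasure, ← integral_complex_ofReal]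
    refine integral_congr_ae (ae_of_all _ fun z => ?_)
    simp only [ContinuousMap.mul_apply, ContinuousMap.star_apply, ContinuousMap.sub_apply,
      ContinuousMap.one_apply, ContinuousMap.smul_apply, coord_apply, Complex.star_def,
      smul_eq_mul, normSq_mul_position]
    have h4 := im_eq_neg_normSq hR hrel z
    rw [← Complex.normSq_eq_norm_sq, Complex.normSq_apply] at h4
    apply Complex.ext
    · simp
      ring
    · simp
      linear_combination -h4

end SelfAdjointResolvent

namespace QuantumWalk

variable {H : Type*} [NormedAddCommGroup H] [InnerProductSpace ℂ H] [CompleteSpace H]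

theorem spectralMeasure_represents {D : H →ₗ.[ℂ] H} (hD : IsSelfAdjoint D) :
    (spectralMeasure D).Represents D :=
  Classical.epsilon_spec (SelfAdjointResolvent.exists_represents hD)

end QuantumWalk

/-! ### Bounded functional calculus of a projection-valued measure -/

namespace ProjectionValuedMeasure

open SpectralRep

variable {H : Type*} [NormedAddCommGroup H] [InnerProductSpace ℂ H] [CompleteSpace H]
variable (E : ProjectionValuedMeasure H)

theorem inner_proj (ξ : H) {s : Set ℝ} (hs : MeasurableSet s) :
    ⟪ξ, E.proj s ξ⟫_ℂ = (((E.measure ξ).real s : ℝ) : ℂ) := by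
  rw [inner_proj_eq E ξ hs, measureReal_apply E ξ hs]

theorem proj_union {s t : Set ℝ} (hs : MeasurableSet s) (ht : MeasurableSet t)
    (hd : Disjoint s t) : E.proj (s ∪ t) = E.proj s + E.proj t := by
  refine clm_ext_inner fun ξ => ?_
  rw [add_apply, inner_add_right, inner_proj E ξ (hs.union ht), inner_proj E ξ hs,
    inner_proj E ξ ht, measureReal_union hd ht, Complex.ofReal_add]

theorem proj_mul_self {s : Set ℝ} (hs : MeasurableSet s) : E.proj s * E.proj s = E.proj s :=
  (E.isStarProjection s hs).isIdempotentElem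

/-- The measure of the vector `E(t) ξ` gives `t` its full mass, so the complement of `t`, and with
it `s`, is null. -/
theorem proj_mul_disjoint {s t : Set ℝ} (hs : MeasurableSet s) (ht : MeasurableSet t)
    (hd : Disjoint s t) : E.proj s * E.proj t = 0 := by
  ext ξ
  have h1 := measureReal_apply E (E.proj t ξ) ht
  have h2 := measureReal_apply E (E.proj t ξ) (ht.compl)
  have h3 := measureReal_apply E (E.proj t ξ) hs
  rw [← mul_apply_eq_comp, proj_mul_self E ht] at h1
  have h4 := measureReal_apply E (E.proj t ξ) MeasurableSet.univ
  rw [E.proj_univ, one_apply_eq_self] at h4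
  have h5 : (E.measure (E.proj t ξ)).real s ≤ (E.measure (E.proj t ξ)).real tᶜ :=
    measureReal_mono hd.subset_compl_right
  rw [measureReal_compl ht, h1, h4, sub_self, h3] at h5
  have h6 : ‖E.proj s (E.proj t ξ)‖ ^ 2 = 0 := le_antisymm h5 (by positivity)
  simpa using h6

theorem proj_mul {s t : Set ℝ} (hs : MeasurableSet s) (ht : MeasurableSet t) :
    E.proj s * E.proj t = E.proj (s ∩ t) := by
  have hst := hs.inter ht
  have h1 : E.proj s = E.proj (s ∩ t) + E.proj (s \ t) := by
    rw [← proj_union E hst (hs.diff ht) Set.disjoint_sdiff_inter.symm, Set.inter_union_sdiff]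
  have h2 : E.proj t = E.proj (s ∩ t) + E.proj (t \ s) := by
    rw [Set.inter_comm, ← proj_union E (ht.inter hs) (ht.diff hs) Set.disjoint_sdiff_inter.symm,
      Set.inter_union_sdiff]
  have d1 : Disjoint (s ∩ t) (t \ s) :=
    Set.disjoint_left.2 fun x hx hx' => hx'.2 hx.1
  have d2 : Disjoint (s \ t) (s ∩ t) :=
    Set.disjoint_left.2 fun x hx hx' => hx.2 hx'.2
  have d3 : Disjoint (s \ t) (t \ s) :=
    Set.disjoint_left.2 fun x hx hx' => hx.2 hx'.1
  rw [h1, h2, add_mul, mul_add, mul_add, proj_mul_self E hst,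
    proj_mul_disjoint E hst (ht.diff hs) d1, proj_mul_disjoint E (hs.diff ht) hst d2,
    proj_mul_disjoint E (hs.diff ht) (ht.diff hs) d3]
  simp

/-- `T` is the operator `∫ g dE`. -/
def IsIntegral (T : H →L[ℂ] H) (g : ℝ → ℂ) : Prop :=
  ∀ ξ : H, ⟪ξ, T ξ⟫_ℂ = ∫ x : ℝ, g x ∂(E.measure ξ)

variable {E}

theorem IsIntegral.unique {T S : H →L[ℂ] H} {g : ℝ → ℂ} (hT : E.IsIntegral T g)
    (hS : E.IsIntegral S g) : T = S :=
  clm_ext_inner fun ξ => (hT ξ).trans (hS ξ).symm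

theorem IsIntegral.star {T : H →L[ℂ] H} {g : ℝ → ℂ} (hT : E.IsIntegral T g) :
    E.IsIntegral (star T) fun x => (starRingEnd ℂ) (g x) := fun ξ => by
  rw [ContinuousLinearMap.star_eq_adjoint, ContinuousLinearMap.adjoint_inner_right,
    ← inner_conj_symm, hT ξ, ← integral_conj]

theorem isIntegral_one : E.IsIntegral 1 fun _ => 1 := fun ξ => by
  have := inner_proj E ξ MeasurableSet.univ
  rw [E.proj_univ] at this
  rw [this]
  simp

variable (E)

/-- The integral of a simple function. -/
noncomputable def simpleIntegral (f : SimpleFunc ℝ ℂ) : H →L[ℂ] H :=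
  ∑ c ∈ f.range, c • E.proj (f ⁻¹' {c})

theorem simpleFunc_eq_sum (f : SimpleFunc ℝ ℂ) (x : ℝ) :
    f x = ∑ c ∈ f.range, c * (f ⁻¹' {c}).indicator (fun _ => 1) x := by
  rw [Finset.sum_eq_single_of_mem (f x) (f.mem_range_self x)]
  · simp
  · intro c _ hc
    have : x ∉ f ⁻¹' {c} := fun h => hc (Eq.symm h)
    rw [Set.indicator_of_notMem this, mul_zero]

theorem isIntegral_simple_mul (f g : SimpleFunc ℝ ℂ) :
    E.IsIntegral (E.simpleIntegral f * E.simpleIntegral g) fun x => f x * g x := fun ξ => by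
  have h1 : E.simpleIntegral f * E.simpleIntegral g =
      ∑ c ∈ f.range, ∑ d ∈ g.range, (c * d) • E.proj (f ⁻¹' {c} ∩ g ⁻¹' {d}) := by
    rw [simpleIntegral, simpleIntegral, Finset.sum_mul_sum]
    refine Finset.sum_congr rfl fun c _ => Finset.sum_congr rfl fun d _ => ?_
    rw [smul_mul_smul_comm, proj_mul E (f.measurableSet_fiber c) (g.measurableSet_fiber d)]
  have h2 : ∀ x, f x * g x = ∑ c ∈ f.range, ∑ d ∈ g.range,
      (c * d) * (f ⁻¹' {c} ∩ g ⁻¹' {d}).indicator (fun _ => 1) x := fun x => by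
    rw [simpleFunc_eq_sum f x, simpleFunc_eq_sum g x, Finset.sum_mul_sum]
    refine Finset.sum_congr rfl fun c _ => Finset.sum_congr rfl fun d _ => ?_
    rw [mul_mul_mul_comm, ← Set.inter_indicator_mul, mul_one]
  have hm : ∀ c d, MeasurableSet (f ⁻¹' {c} ∩ g ⁻¹' {d}) := fun c d =>
    (f.measurableSet_fiber c).inter (g.measurableSet_fiber d)
  have hi : ∀ c d, Integrable (fun x => (c * d) *
      (f ⁻¹' {c} ∩ g ⁻¹' {d}).indicator (fun _ => (1 : ℂ)) x) (E.measure ξ) := fun c d =>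
    ((integrable_const (1 : ℂ)).indicator (hm c d)).const_mul _
  simp_rw [h2]
  rw [integral_finsetSum _ fun c _ => integrable_finsetSum _ fun d _ => hi c d, h1,
    sum_apply, inner_sum]
  refine Finset.sum_congr rfl fun c _ => ?_
  rw [integral_finsetSum _ fun d _ => hi c d, sum_apply, inner_sum]
  refine Finset.sum_congr rfl fun d _ => ?_
  rw [smul_apply, inner_smul_right, inner_proj E ξ (hm c d), integral_const_mul,
    integral_indicator_const _ (hm c d)]
  simp

theorem simpleIntegral_one : E.simpleIntegral 1 = 1 := by
  rw [simpleIntegral]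
  have : (1 : SimpleFunc ℝ ℂ).range = {1} := SimpleFunc.range_const ℝ 1
  rw [this, Finset.sum_singleton, one_smul, ← E.proj_univ]
  congr 1
  ext x
  simp

theorem isIntegral_simple (f : SimpleFunc ℝ ℂ) : E.IsIntegral (E.simpleIntegral f) f := by
  have := isIntegral_simple_mul E f 1
  simpa [simpleIntegral_one] using this

variable {E}

theorem IsIntegral.sub {T S : H →L[ℂ] H} {g h : ℝ → ℂ} (hT : E.IsIntegral T g)
    (hS : E.IsIntegral S h) (hg : ∀ ξ, Integrable g (E.measure ξ))
    (hh : ∀ ξ, Integrable h (E.measure ξ)) : E.IsIntegral (T - S) fun x => g x - h x := fun ξ => by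
  rw [integral_sub (hg ξ) (hh ξ), sub_apply, inner_sub_right, hT ξ, hS ξ]

/-- This bound by the supremum norm makes uniformly Cauchy simple functions yield norm-Cauchy
operators. -/
theorem norm_simpleIntegral_le (f : SimpleFunc ℝ ℂ) {C : ℝ} (hC : 0 ≤ C) (hf : ∀ x, ‖f x‖ ≤ C) :
    ‖E.simpleIntegral f‖ ≤ C := by
  refine ContinuousLinearMap.opNorm_le_bound _ hC fun ξ => ?_
  refine le_of_sq_le_sq ?_ (by positivity)
  have h1 : star (E.simpleIntegral f) = E.simpleIntegral (f.map (starRingEnd ℂ)) :=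
    (isIntegral_simple E f).star.unique (isIntegral_simple E (f.map (starRingEnd ℂ)))
  have h2 := isIntegral_simple_mul E (f.map (starRingEnd ℂ)) f ξ
  rw [← h1, mul_apply_eq_comp, ContinuousLinearMap.star_eq_adjoint,
    ContinuousLinearMap.adjoint_inner_right, inner_self_eq_norm_sq_to_K] at h2
  have h3 : ∀ x, (f.map (starRingEnd ℂ)) x * f x = ((‖f x‖ ^ 2 : ℝ) : ℂ) := fun x => by
    rw [SimpleFunc.map_apply, Complex.conj_mul']
    push_cast
    rfl
  simp_rw [h3] at h2
  rw [integral_complex_ofReal] at h2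
  have h4 : ‖E.simpleIntegral f ξ‖ ^ 2 = ∫ x, ‖f x‖ ^ 2 ∂(E.measure ξ) :=
    Complex.ofReal_injective (by simpa using h2)
  have h5 : ∫ x, ‖f x‖ ^ 2 ∂(E.measure ξ) ≤ ∫ _, C ^ 2 ∂(E.measure ξ) := by
    refine integral_mono_of_nonneg (ae_of_all _ fun x => by positivity) (integrable_const _)
      (ae_of_all _ fun x => ?_)
    have := hf x
    simp only
    gcongr
  rw [integral_const, smul_eq_mul, measureReal_apply E ξ MeasurableSet.univ, E.proj_univ,
    one_apply_eq_self] at h5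
  rw [h4]
  linarith

/-- The approximation must be uniform: the values lie in a compact disc, finitely many `ε`-balls
around a dense sequence cover it, and `g` is rounded to a nearest centre. -/
theorem exists_simpleFunc_dist_lt {g : ℝ → ℂ} (hg : Measurable g) {C : ℝ} (hC : ∀ x, ‖g x‖ ≤ C)
    {ε : ℝ} (hε : 0 < ε) : ∃ f : SimpleFunc ℝ ℂ, ∀ x, ‖f x - g x‖ < ε := by
  let e := TopologicalSpace.denseSeq ℂ
  have hcov : Metric.closedBall (0 : ℂ) C ⊆ ⋃ n, Metric.ball (e n) ε := fun z _ => by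
    obtain ⟨n, hn⟩ := (TopologicalSpace.denseRange_denseSeq ℂ).exists_dist_lt z hε
    exact Set.mem_iUnion.2 ⟨n, hn⟩
  obtain ⟨F, hF⟩ := (isCompact_closedBall (0 : ℂ) C).elim_finite_subcover _
    (fun n => Metric.isOpen_ball) hcov
  refine ⟨(SimpleFunc.nearestPt e (F.sup id)).comp g hg, fun x => ?_⟩
  obtain ⟨n, hnF, hn⟩ := Set.mem_iUnion₂.1 (hF (mem_closedBall_zero_iff.2 (hC x)))
  have h1 := SimpleFunc.edist_nearestPt_le e (g x) (Finset.le_sup (f := id) hnF)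
  rw [edist_dist, edist_dist, ENNReal.ofReal_le_ofReal_iff dist_nonneg] at h1
  rw [← dist_eq_norm]
  refine lt_of_le_of_lt h1 ?_
  rw [dist_comm]
  exact hn

theorem IsIntegral.of_tendsto {T : ℕ → H →L[ℂ] H} {S : H →L[ℂ] H} {f : ℕ → ℝ → ℂ} {g : ℝ → ℂ}
    (hT : ∀ n, E.IsIntegral (T n) (f n)) (hTS : Tendsto T atTop (𝓝 S))
    (hf : ∀ n, Measurable (f n)) {C : ℝ} (hC : ∀ n x, ‖f n x‖ ≤ C)
    (hfg : ∀ x, Tendsto (fun n => f n x) atTop (𝓝 (g x))) : E.IsIntegral S g := fun ξ => by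
  have h1 : Tendsto (fun n => ⟪ξ, T n ξ⟫_ℂ) atTop (𝓝 ⟪ξ, S ξ⟫_ℂ) :=
    tendsto_const_nhds.inner (((ContinuousLinearMap.apply ℂ H ξ).continuous.tendsto S).comp hTS)
  refine tendsto_nhds_unique h1 ?_
  simp_rw [hT _ ξ]
  exact tendsto_integral_of_dominated_convergence (fun _ => C)
    (fun n => (hf n).aestronglyMeasurable) (integrable_const C)
    (fun n => ae_of_all _ (hC n)) (ae_of_all _ hfg)

theorem exists_approx_isIntegral {g : ℝ → ℂ} (hg : Measurable g) {C : ℝ} (hC : ∀ x, ‖g x‖ ≤ C) :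
    ∃ f : ℕ → SimpleFunc ℝ ℂ, (∀ n x, ‖f n x‖ ≤ C + 1) ∧
      (∀ x, Tendsto (fun n => f n x) atTop (𝓝 (g x))) ∧
      ∃ T, Tendsto (fun n => E.simpleIntegral (f n)) atTop (𝓝 T) ∧ E.IsIntegral T g := by
  have hpos : ∀ n : ℕ, (0 : ℝ) < 1 / ((n : ℝ) + 1) := fun n => by positivity
  choose f hf using fun n : ℕ => exists_simpleFunc_dist_lt hg hC (hpos n)
  have hle : ∀ n : ℕ, 1 / ((n : ℝ) + 1) ≤ 1 := fun n => by
    rw [div_le_one (by positivity)]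
    linarith [(n.cast_nonneg : (0 : ℝ) ≤ n)]
  have hb : ∀ n x, ‖f n x‖ ≤ C + 1 := fun n x => by
    have := norm_add_le (f n x - g x) (g x)
    rw [sub_add_cancel] at this
    linarith [hf n x, hle n, hC x]
  have hlim : ∀ x, Tendsto (fun n => f n x) atTop (𝓝 (g x)) := fun x => by
    rw [tendsto_iff_norm_sub_tendsto_zero]
    exact squeeze_zero (fun n => norm_nonneg _) (fun n => (hf n x).le)
      tendsto_one_div_add_atTop_nhds_zero_nat
  have hint : ∀ n ξ, Integrable (f n) (E.measure ξ) := fun n ξ =>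
    SimpleFunc.integrable_of_isFiniteMeasure _
  have hsub : ∀ m n, E.simpleIntegral (f m) - E.simpleIntegral (f n) =
      E.simpleIntegral (f m - f n) := fun m n =>
    ((isIntegral_simple E (f m)).sub (isIntegral_simple E (f n)) (hint m) (hint n)).unique
      (isIntegral_simple E (f m - f n))
  have hcau : CauchySeq fun n => E.simpleIntegral (f n) := by
    refine Metric.cauchySeq_iff'.2 fun ε hε => ?_
    obtain ⟨N, hN⟩ := exists_nat_one_div_lt (show 0 < ε / 3 by positivity)
    refine ⟨N, fun n hn => ?_⟩
    rw [dist_eq_norm, hsub]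
    refine lt_of_le_of_lt (norm_simpleIntegral_le _ (C := ε / 3 + ε / 3) (by positivity)
      fun x => ?_) (by linarith)
    rw [SimpleFunc.coe_sub, Pi.sub_apply, ← sub_sub_sub_cancel_right (f n x) (f N x) (g x)]
    have h1 : 1 / ((n : ℝ) + 1) ≤ 1 / ((N : ℝ) + 1) := by gcongr
    have := norm_sub_le (f n x - g x) (f N x - g x)
    linarith [hf n x, hf N x]
  obtain ⟨T, hT⟩ := cauchySeq_tendsto_of_complete hcau
  exact ⟨f, hb, hlim, T, hT, IsIntegral.of_tendsto (fun n => isIntegral_simple E (f n)) hT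
    (fun n => (f n).measurable) hb hlim⟩

theorem exists_isIntegral {g : ℝ → ℂ} (hg : Measurable g) {C : ℝ} (hC : ∀ x, ‖g x‖ ≤ C) :
    ∃ T, E.IsIntegral T g := by
  obtain ⟨_, _, _, T, _, hT⟩ := exists_approx_isIntegral (E := E) hg hC
  exact ⟨T, hT⟩

/-- An operator is determined by its quadratic form, so both factors are norm limits of integrals of
simple functions, for which multiplicativity is `proj_mul`. -/
theorem IsIntegral.mul {T S : H →L[ℂ] H} {g h : ℝ → ℂ} (hT : E.IsIntegral T g)
    (hS : E.IsIntegral S h) (hg : Measurable g) (hh : Measurable h) {C : ℝ}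
    (hgC : ∀ x, ‖g x‖ ≤ C) (hhC : ∀ x, ‖h x‖ ≤ C) : E.IsIntegral (T * S) fun x => g x * h x := by
  obtain ⟨f, hf1, hf2, T', hf3, hT'⟩ := exists_approx_isIntegral (E := E) hg hgC
  obtain ⟨k, hk1, hk2, S', hk3, hS'⟩ := exists_approx_isIntegral (E := E) hh hhC
  rw [hT.unique hT', hS.unique hS']
  refine IsIntegral.of_tendsto (fun n => isIntegral_simple_mul E (f n) (k n)) (hf3.mul hk3)
    (fun n => (f n).measurable.mul (k n).measurable) (C := (C + 1) * (C + 1)) (fun n x => ?_)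
    fun x => (hf2 x).mul (hk2 x)
  rw [norm_mul]
  exact mul_le_mul (hf1 n x) (hk1 n x) (norm_nonneg _) ((norm_nonneg _).trans (hf1 n x))

theorem isIntegral_integral {g : ℝ → ℂ} (hg : Measurable g) {C : ℝ} (hC : ∀ x, ‖g x‖ ≤ C) :
    E.IsIntegral (E.integral g) g :=
  Classical.epsilon_spec (exists_isIntegral (E := E) hg hC)

end ProjectionValuedMeasure

/-! ### The unitary group generated by a self-adjoint operator -/

namespace QuantumWalk

variable {H : Type*} [NormedAddCommGroup H] [InnerProductSpace ℂ H] [CompleteSpace H]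
variable (D : H →ₗ.[ℂ] H)

theorem norm_exp_I_mul (k x : ℝ) : ‖Complex.exp (Complex.I * k * x)‖ = 1 := by
  rw [mul_assoc, mul_comm, ← Complex.ofReal_mul, Complex.norm_exp_ofReal_mul_I]

theorem measurable_exp_I_mul (k : ℝ) : Measurable fun x : ℝ => Complex.exp (Complex.I * k * x) :=
  by fun_prop

theorem expI_isIntegral (k : ℝ) : (spectralMeasure D).IsIntegral (expI D k)
    fun x : ℝ => Complex.exp (Complex.I * k * x) :=
  ProjectionValuedMeasure.isIntegral_integral (measurable_exp_I_mul k)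
    fun x => (norm_exp_I_mul k x).le

theorem expI_zero : expI D 0 = 1 :=
  (expI_isIntegral D 0).unique (by simpa using ProjectionValuedMeasure.isIntegral_one)

theorem expI_add (k l : ℝ) : expI D (k + l) = expI D k * expI D l := by
  refine (expI_isIntegral D (k + l)).unique ?_
  have := (expI_isIntegral D k).mul (expI_isIntegral D l) (measurable_exp_I_mul k)
    (measurable_exp_I_mul l) (C := 1) (fun x => (norm_exp_I_mul k x).le)
    fun x => (norm_exp_I_mul l x).le
  convert this using 2 with x
  rw [← Complex.exp_add]
  push_cast
  ring_nf

theorem star_expI (k : ℝ) : star (expI D k) = expI D (-k) := by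
  refine (expI_isIntegral D k).star.unique ?_
  convert expI_isIntegral D (-k) using 2 with x
  rw [← Complex.exp_conj]
  simp

theorem expI_neg_mul (k : ℝ) : expI D (-k) * expI D k = 1 := by
  rw [← expI_add, neg_add_cancel, expI_zero]

theorem expI_neg_apply (k : ℝ) (ξ : H) : expI D (-k) (expI D k ξ) = ξ :=
  DFunLike.congr_fun (expI_neg_mul D k) ξ

theorem inner_expI_left (k : ℝ) (ξ η : H) : ⟪expI D k ξ, η⟫_ℂ = ⟪ξ, expI D (-k) η⟫_ℂ := by
  rw [← star_expI, ContinuousLinearMap.star_eq_adjoint, ContinuousLinearMap.adjoint_inner_right]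

@[simp] theorem norm_expI_apply (k : ℝ) (ξ : H) : ‖expI D k ξ‖ = ‖ξ‖ := by
  have h : ⟪expI D k ξ, expI D k ξ⟫_ℂ = ⟪ξ, ξ⟫_ℂ := by rw [inner_expI_left, expI_neg_apply]
  rw [inner_self_eq_norm_sq_to_K, inner_self_eq_norm_sq_to_K] at h
  have h2 : ‖expI D k ξ‖ ^ 2 = ‖ξ‖ ^ 2 := Complex.ofReal_injective (by simpa using h)
  exact (pow_left_inj₀ (norm_nonneg _) (norm_nonneg _) two_ne_zero).1 h2

theorem charFun_measure (ξ : H) (k : ℝ) :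
    charFun ((spectralMeasure D).measure ξ) k = ⟪ξ, expI D k ξ⟫_ℂ := by
  rw [charFun_apply_real, expI_isIntegral D k ξ]
  congr 1
  ext x
  ring_nf

end QuantumWalk

/-! ### Differentiability along the unitary group -/

namespace QuantumWalk

open SpectralRep ProjectionValuedMeasure

variable {H : Type*} [NormedAddCommGroup H] [InnerProductSpace ℂ H] [CompleteSpace H]
variable (D : H →ₗ.[ℂ] H)

/-- The difference quotient `(e^{ihx} - 1) / h`. -/
noncomputable def expQuot (h x : ℝ) : ℂ := ((h⁻¹ : ℝ) : ℂ) * (Complex.exp (Complex.I * h * x) - 1)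

theorem measurable_expQuot (h : ℝ) : Measurable (expQuot h) :=
  ((measurable_exp_I_mul h).sub_const 1).const_mul _

theorem norm_expQuot_le (h x : ℝ) : ‖expQuot h x‖ ≤ |x| := by
  have := Real.norm_exp_I_mul_ofReal_sub_one_le (x := h * x)
  rw [expQuot, norm_mul, Complex.norm_real, norm_inv, Real.norm_eq_abs]
  rw [Real.norm_eq_abs, abs_mul, Complex.ofReal_mul, ← mul_assoc] at this
  by_cases hh : h = 0
  · simp [hh]
  · rw [inv_mul_le_iff₀ (abs_pos.2 hh)]
    exact this

theorem norm_expQuot_le_const (h x : ℝ) : ‖expQuot h x‖ ≤ |h⁻¹| * 2 := by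
  rw [expQuot, norm_mul, Complex.norm_real, Real.norm_eq_abs]
  gcongr
  refine (norm_sub_le _ _).trans ?_
  rw [norm_exp_I_mul, norm_one]
  norm_num

theorem tendsto_expQuot (x : ℝ) :
    Tendsto (fun h => expQuot h x) (𝓝[≠] 0) (𝓝 (Complex.I * x)) := by
  have h1 : HasDerivAt (fun h : ℝ => Complex.exp (Complex.I * h * x)) (Complex.I * x) 0 := by
    have h2 : HasDerivAt (fun h : ℝ => Complex.I * h * x) (Complex.I * x) 0 := by
      have := ((Complex.ofRealCLM.hasDerivAt (x := (0 : ℝ))).const_mul Complex.I).mul_const (x : ℂ)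
      simpa using this
    have := h2.cexp
    simpa using this
  rw [hasDerivAt_iff_tendsto_slope_zero] at h1
  refine h1.congr fun h => ?_
  simp [expQuot]

/-- The difference quotient `(e^{ihD} - 1) / h`. -/
noncomputable def diffQuot (h : ℝ) : H →L[ℂ] H := ((h⁻¹ : ℝ) : ℂ) • (expI D h - 1)

theorem diffQuot_isIntegral (h : ℝ) :
    (spectralMeasure D).IsIntegral (diffQuot D h) (expQuot h) := fun ξ => by
  have h1 := (expI_isIntegral D h).sub isIntegral_one
    (fun ξ => Integrable.of_bound (measurable_exp_I_mul h).aestronglyMeasurable 1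
      (ae_of_all _ fun x => (norm_exp_I_mul h x).le)) (fun ξ => integrable_const _) ξ
  rw [diffQuot, smul_apply, inner_smul_right, h1, ← integral_const_mul]
  rfl

theorem hasDerivAt_expI_zero_iff (ξ A : H) :
    HasDerivAt (fun k => expI D k ξ) A 0 ↔
      Tendsto (fun h => diffQuot D h ξ) (𝓝[≠] 0) (𝓝 A) := by
  rw [hasDerivAt_iff_tendsto_slope_zero]
  refine tendsto_congr fun h => ?_
  rw [zero_add, expI_zero, diffQuot, smul_apply, sub_apply, one_apply_eq_self]
  rfl

end QuantumWalk

namespace ProjectionValuedMeasure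

variable {H : Type*} [NormedAddCommGroup H] [InnerProductSpace ℂ H] [CompleteSpace H]
variable {E : ProjectionValuedMeasure H}

theorem IsIntegral.norm_sq {T : H →L[ℂ] H} {g : ℝ → ℂ} (hT : E.IsIntegral T g)
    (hg : Measurable g) {C : ℝ} (hC : ∀ x, ‖g x‖ ≤ C) (ξ : H) :
    ‖T ξ‖ ^ 2 = ∫ x, ‖g x‖ ^ 2 ∂(E.measure ξ) := by
  have h := hT.star.mul hT (Complex.continuous_conj.measurable.comp hg) hg
    (fun x => by rw [RCLike.norm_conj]; exact hC x) hC ξ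
  rw [mul_apply_eq_comp, ContinuousLinearMap.star_eq_adjoint,
    ContinuousLinearMap.adjoint_inner_right, inner_self_eq_norm_sq_to_K] at h
  have h3 : ∀ x, (starRingEnd ℂ) (g x) * g x = ((‖g x‖ ^ 2 : ℝ) : ℂ) := fun x => by
    rw [Complex.conj_mul']
    push_cast
    rfl
  simp_rw [h3] at h
  rw [integral_complex_ofReal] at h
  exact Complex.ofReal_injective (by simpa using h)

end ProjectionValuedMeasure

namespace QuantumWalk

open SpectralRep ProjectionValuedMeasure

variable {H : Type*} [NormedAddCommGroup H] [InnerProductSpace ℂ H] [CompleteSpace H]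
variable (D : H →ₗ.[ℂ] H)

theorem norm_diffQuot_sq (h : ℝ) (ξ : H) :
    ‖diffQuot D h ξ‖ ^ 2 = ∫ x, ‖expQuot h x‖ ^ 2 ∂((spectralMeasure D).measure ξ) :=
  (diffQuot_isIntegral D h).norm_sq (measurable_expQuot h) (norm_expQuot_le_const h) ξ

theorem integrable_expQuot (h : ℝ) (ξ : H) :
    Integrable (expQuot h) ((spectralMeasure D).measure ξ) :=
  Integrable.of_bound (measurable_expQuot h).aestronglyMeasurable _
    (ae_of_all _ (norm_expQuot_le_const h))

theorem norm_diffQuot_sub_sq (h l : ℝ) (ξ : H) :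
    ‖diffQuot D h ξ - diffQuot D l ξ‖ ^ 2 =
      ∫ x, ‖expQuot h x - expQuot l x‖ ^ 2 ∂((spectralMeasure D).measure ξ) :=
  ((diffQuot_isIntegral D h).sub (diffQuot_isIntegral D l) (integrable_expQuot D h)
    (integrable_expQuot D l)).norm_sq ((measurable_expQuot h).sub (measurable_expQuot l))
    (C := |h⁻¹| * 2 + |l⁻¹| * 2) (fun x => (norm_sub_le _ _).trans
      (add_le_add (norm_expQuot_le_const h x) (norm_expQuot_le_const l x))) ξ

/-- The difference quotients converge to `i x` in `L²` of the spectral measure, dominated by a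
multiple of `x²`; hence they are Cauchy in `H`. -/
theorem exists_hasDerivAt (ξ : H)
    (hξ : Integrable (fun x : ℝ => x ^ 2) ((spectralMeasure D).measure ξ)) :
    ∃ A, HasDerivAt (fun k => expI D k ξ) A 0 := by
  set μ := (spectralMeasure D).measure ξ
  have hm : ∀ h, Measurable fun x : ℝ => ‖expQuot h x - Complex.I * x‖ ^ 2 := fun h =>
    ((measurable_expQuot h).sub (by fun_prop)).norm.pow_const 2
  have hb : ∀ h x, ‖expQuot h x - Complex.I * x‖ ^ 2 ≤ 4 * x ^ 2 := fun h x => by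
    have h1 : ‖expQuot h x - Complex.I * x‖ ≤ |x| + |x| := by
      refine (norm_sub_le _ _).trans (add_le_add (norm_expQuot_le h x) ?_)
      simp
    have : (|x| + |x|) ^ 2 = 4 * x ^ 2 := by rw [← sq_abs x]; ring
    rw [← this]
    gcongr
  have hb' : ∀ h, ∀ᵐ x ∂μ, ‖(‖expQuot h x - Complex.I * x‖ ^ 2)‖ ≤ 4 * x ^ 2 := fun h =>
    ae_of_all _ fun x => by
      rw [Real.norm_eq_abs, abs_of_nonneg (by positivity)]
      exact hb h x
  have hi : ∀ h, Integrable (fun x : ℝ => ‖expQuot h x - Complex.I * x‖ ^ 2) μ := fun h =>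
    (hξ.const_mul 4).mono' (hm h).aestronglyMeasurable (hb' h)
  have hlim : Tendsto (fun h => ∫ x, ‖expQuot h x - Complex.I * x‖ ^ 2 ∂μ) (𝓝[≠] 0) (𝓝 0) := by
    have := tendsto_integral_filter_of_dominated_convergence (μ := μ) (l := 𝓝[≠] (0 : ℝ))
      (F := fun h (x : ℝ) => ‖expQuot h x - Complex.I * x‖ ^ 2) (f := fun _ => 0)
      (fun x => 4 * x ^ 2) (Eventually.of_forall fun h => (hm h).aestronglyMeasurable)
      (Eventually.of_forall hb') (hξ.const_mul 4)
      (ae_of_all _ fun x => by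
        have := (((tendsto_expQuot x).sub_const (Complex.I * x)).norm).pow 2
        simpa using this)
    simpa using this
  have hcau : Cauchy (map (fun h => diffQuot D h ξ) (𝓝[≠] 0)) := by
    rw [Metric.cauchy_iff]
    refine ⟨inferInstance, fun ε hε => ?_⟩
    have hev := hlim.eventually (gt_mem_nhds (show 0 < ε ^ 2 / 4 by positivity))
    refine ⟨_, image_mem_map hev, ?_⟩
    rintro _ ⟨h, hh, rfl⟩ _ ⟨l, hl, rfl⟩
    rw [dist_eq_norm]
    refine lt_of_pow_lt_pow_left₀ 2 hε.le ?_
    rw [norm_diffQuot_sub_sq]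
    have : ∫ x, ‖expQuot h x - expQuot l x‖ ^ 2 ∂μ ≤
        ∫ x, (2 * ‖expQuot h x - Complex.I * x‖ ^ 2 + 2 * ‖expQuot l x - Complex.I * x‖ ^ 2) ∂μ := by
      refine integral_mono_of_nonneg (ae_of_all _ fun x => by positivity)
        (((hi h).const_mul 2).add ((hi l).const_mul 2)) (ae_of_all _ fun x => ?_)
      have h1 : ‖expQuot h x - expQuot l x‖ ≤
          ‖expQuot h x - Complex.I * x‖ + ‖expQuot l x - Complex.I * x‖ := by
        rw [← sub_sub_sub_cancel_right (expQuot h x) (expQuot l x) (Complex.I * x)]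
        exact norm_sub_le _ _
      have h2 := norm_nonneg (expQuot h x - expQuot l x)
      simp only
      nlinarith [sq_nonneg (‖expQuot h x - Complex.I * x‖ - ‖expQuot l x - Complex.I * x‖)]
    rw [integral_add ((hi h).const_mul 2) ((hi l).const_mul 2), integral_const_mul,
      integral_const_mul] at this
    have hh' : ∫ x, ‖expQuot h x - Complex.I * x‖ ^ 2 ∂μ < ε ^ 2 / 4 := hh
    have hl' : ∫ x, ‖expQuot l x - Complex.I * x‖ ^ 2 ∂μ < ε ^ 2 / 4 := hl
    linarith
  obtain ⟨A, hA⟩ := CompleteSpace.complete hcau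
  exact ⟨A, (hasDerivAt_expI_zero_iff D ξ A).2 hA⟩

variable {D}

/-- Fatou's lemma along `h = 1/(n+1)`: the integrals of `‖expQuot h‖²` are the squared norms of the
difference quotients, which converge. -/
theorem integrable_sq_of_hasDerivAt {ξ A : H} (hA : HasDerivAt (fun k => expI D k ξ) A 0) :
    Integrable (fun x : ℝ => x ^ 2) ((spectralMeasure D).measure ξ) := by
  rw [hasDerivAt_expI_zero_iff] at hA
  have hseq : Tendsto (fun n : ℕ => 1 / ((n : ℝ) + 1)) atTop (𝓝[≠] 0) :=
    tendsto_nhdsWithin_iff.2 ⟨tendsto_one_div_add_atTop_nhds_zero_nat,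
      Eventually.of_forall fun n => ne_of_gt (by positivity)⟩
  refine integrable_of_tendsto (G := fun n x => ‖expQuot (1 / ((n : ℝ) + 1)) x‖ ^ 2)
    (ae_of_all _ fun x => ?_) (fun n => ((measurable_expQuot _).norm.pow_const 2).aestronglyMeasurable) ?_
  · have := (((tendsto_expQuot x).comp hseq).norm).pow 2
    simpa using this
  · have h1 : ∀ n : ℕ, ∫⁻ x, ‖(‖expQuot (1 / ((n : ℝ) + 1)) x‖ ^ 2)‖ₑ
        ∂((spectralMeasure D).measure ξ) =
        ENNReal.ofReal (‖diffQuot D (1 / ((n : ℝ) + 1)) ξ‖ ^ 2) := fun n => by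
      rw [norm_diffQuot_sq, ofReal_integral_eq_lintegral_ofReal]
      · refine lintegral_congr fun x => ?_
        rw [Real.enorm_eq_ofReal (by positivity)]
      · exact Integrable.of_bound ((measurable_expQuot _).norm.pow_const 2).aestronglyMeasurable
          ((|(1 / ((n : ℝ) + 1))⁻¹| * 2) ^ 2) (ae_of_all _ fun x => by
            rw [Real.norm_eq_abs, abs_of_nonneg (by positivity)]
            have := norm_expQuot_le_const (1 / ((n : ℝ) + 1)) x
            gcongr)
      · exact ae_of_all _ fun x => by positivity
    simp_rw [h1]
    have h2 := ENNReal.tendsto_ofReal (((hA.comp hseq).norm).pow 2)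
    have h3 := h2.liminf_eq
    simp only [Function.comp_def] at h3
    rw [h3]
    exact ENNReal.ofReal_ne_top

/-- Formally `A = i D ξ`, which multiplies the spectral measure by `x²`. The characteristic
functions agree: pass to the limit in `⟨T ξ, e^{ikD} T ξ⟩` with `T` the difference quotient. -/
theorem measure_eq_withDensity_of_hasDerivAt {ξ A : H}
    (hA : HasDerivAt (fun k => expI D k ξ) A 0) :
    (spectralMeasure D).measure A =
      ((spectralMeasure D).measure ξ).withDensity fun x => (‖x‖₊ ^ 2 : NNReal) := by
  have hint := integrable_sq_of_hasDerivAt hA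
  set μ := (spectralMeasure D).measure ξ with hμ
  have hm : Measurable fun x : ℝ => (‖x‖₊ ^ 2 : NNReal) := by fun_prop
  have hfin : IsFiniteMeasure (μ.withDensity fun x => ((‖x‖₊ ^ 2 : NNReal) : ENNReal)) := by
    have h := isFiniteMeasure_withDensity_ofReal hint.2
    convert h using 3 with x
    rw [← ENNReal.ofReal_coe_nnreal]
    simp
  rw [hasDerivAt_expI_zero_iff] at hA
  refine Measure.ext_of_charFun ?_
  ext k
  rw [charFun_measure, charFun_apply_real, integral_withDensity_eq_integral_smul hm]
  have h1 : Tendsto (fun h => ⟪diffQuot D h ξ, expI D k (diffQuot D h ξ)⟫_ℂ) (𝓝[≠] 0)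
      (𝓝 ⟪A, expI D k A⟫_ℂ) :=
    hA.inner (((expI D k).continuous.tendsto A).comp hA)
  refine tendsto_nhds_unique h1 ?_
  have h2 : ∀ h, ⟪diffQuot D h ξ, expI D k (diffQuot D h ξ)⟫_ℂ =
      ∫ x, (starRingEnd ℂ) (expQuot h x) * (Complex.exp (Complex.I * k * x) * expQuot h x) ∂μ :=
    fun h => by
      have hb := norm_expQuot_le_const h
      have h3 := (expI_isIntegral D k).mul (diffQuot_isIntegral D h) (measurable_exp_I_mul k)
        (measurable_expQuot h) (C := max 1 (|h⁻¹| * 2))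
        (fun x => (norm_exp_I_mul k x).le.trans (le_max_left _ _))
        (fun x => (hb x).trans (le_max_right _ _))
      have h4 := (diffQuot_isIntegral D h).star.mul h3
        (Complex.continuous_conj.measurable.comp (measurable_expQuot h))
        ((measurable_exp_I_mul k).mul (measurable_expQuot h)) (C := |h⁻¹| * 2)
        (fun x => by rw [RCLike.norm_conj]; exact hb x)
        (fun x => by rw [norm_mul, norm_exp_I_mul, one_mul]; exact hb x) ξ
      rw [← h4, mul_apply_eq_comp, mul_apply_eq_comp, ContinuousLinearMap.star_eq_adjoint,
        ContinuousLinearMap.adjoint_inner_right]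
  simp_rw [h2]
  refine tendsto_integral_filter_of_dominated_convergence (fun x => x ^ 2)
    (Eventually.of_forall fun h => ?_) (Eventually.of_forall fun h => ae_of_all _ fun x => ?_)
    hint (ae_of_all _ fun x => ?_)
  · exact ((Complex.continuous_conj.measurable.comp (measurable_expQuot h)).mul
      ((measurable_exp_I_mul k).mul (measurable_expQuot h))).aestronglyMeasurable
  · rw [norm_mul, norm_mul, norm_exp_I_mul, one_mul, RCLike.norm_conj, ← sq, ← sq_abs x]
    have := norm_expQuot_le h x
    gcongr
  · have h5 := tendsto_expQuot x
    have h6 := ((Complex.continuous_conj.tendsto _).comp h5).mul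
      ((tendsto_const_nhds (x := Complex.exp (Complex.I * k * x))).mul h5)
    refine h6.congr' (Eventually.of_forall fun h => rfl) |>.trans (le_of_eq ?_)
    congr 1
    have h7 : ((‖x‖₊ ^ 2 : NNReal) • Complex.exp (k * x * Complex.I) : ℂ) =
        (x : ℂ) ^ 2 * Complex.exp (k * x * Complex.I) := by
      rw [NNReal.smul_def, NNReal.coe_pow, coe_nnnorm, Real.norm_eq_abs, sq_abs]
      simp
    rw [h7, map_mul, Complex.conj_I, Complex.conj_ofReal,
      show Complex.I * k * x = k * x * Complex.I by ring]
    linear_combination (-(x : ℂ) ^ 2 * Complex.exp (k * x * Complex.I)) * Complex.I_sq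

theorem mem_domain_of_hasDerivAt (hD : IsSelfAdjoint D) {ξ A : H}
    (hA : HasDerivAt (fun k => expI D k ξ) A 0) : ξ ∈ D.domain :=
  ((spectralMeasure_represents hD).1 ξ).2 (integrable_sq_of_hasDerivAt hA)

theorem inner_hasDerivAt_eq (hD : IsSelfAdjoint D) (ξ : D.domain) {A : H}
    (hA : HasDerivAt (fun k => expI D k (ξ : H)) A 0) :
    ⟪(ξ : H), A⟫_ℂ = Complex.I * ⟪(ξ : H), D ξ⟫_ℂ := by
  have hint := ((spectralMeasure_represents hD).1 ξ).1 ξ.2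
  set μ := (spectralMeasure D).measure (ξ : H) with hμ
  have hbd : Integrable (fun x : ℝ => 1 + x ^ 2) μ := (integrable_const (1 : ℝ)).add hint
  have h1 : ⟪(ξ : H), D ξ⟫_ℂ = ((∫ x : ℝ, x ∂μ : ℝ) : ℂ) := (spectralMeasure_represents hD).2 ξ
  have h2 : Tendsto (fun h => ⟪(ξ : H), diffQuot D h ξ⟫_ℂ) (𝓝[≠] 0) (𝓝 ⟪(ξ : H), A⟫_ℂ) :=
    tendsto_const_nhds.inner ((hasDerivAt_expI_zero_iff D ξ A).1 hA)
  have h3 : Tendsto (fun h => ∫ x, expQuot h x ∂μ) (𝓝[≠] 0) (𝓝 (∫ x : ℝ, Complex.I * x ∂μ)) := by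
    refine tendsto_integral_filter_of_dominated_convergence (fun x : ℝ => 1 + x ^ 2)
      (Eventually.of_forall fun h => (measurable_expQuot h).aestronglyMeasurable)
      (Eventually.of_forall fun h => ae_of_all _ fun x => ?_)
      hbd (ae_of_all _ fun x => tendsto_expQuot x)
    refine (norm_expQuot_le h x).trans ?_
    rw [← sq_abs x]
    nlinarith [sq_nonneg (|x| - 1), abs_nonneg x]
  rw [h1, ← integral_complex_ofReal, ← integral_const_mul]
  exact tendsto_nhds_unique h2 (h3.congr fun h => (diffQuot_isIntegral D h (ξ : H)).symm)

/-- The generator of the unitary group is `i D`. -/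
theorem hasDerivAt_expI_zero (hD : IsSelfAdjoint D) (ξ : D.domain) :
    HasDerivAt (fun k => expI D k (ξ : H)) (Complex.I • D ξ) 0 := by
  choose A hA using fun ξ : D.domain =>
    exists_hasDerivAt D (ξ : H) (((spectralMeasure_represents hD).1 ξ).1 ξ.2)
  have hadd : ∀ ξ η, A (ξ + η) = A ξ + A η := fun ξ η => by
    have := (hA ξ).add (hA η)
    refine (hA (ξ + η)).unique (this.congr_of_eventuallyEq (Eventually.of_forall fun k => ?_))
    simp
  have hsmul : ∀ (c : ℂ) ξ, A (c • ξ) = c • A ξ := fun c ξ => by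
    have := (hA ξ).const_smul c
    refine (hA (c • ξ)).unique (this.congr_of_eventuallyEq (Eventually.of_forall fun k => ?_))
    simp
  -- `Represents` prescribes only the quadratic form of `D`, so a priori only `⟨ξ, B ξ⟩ = 0` is
  -- known. Testing on `ξ + η` and `ξ + i η` gives `⟨η, B ξ⟩ = 0` on the dense domain.
  let B : D.domain → H := fun ξ => A ξ - Complex.I • D ξ
  have hB0 : ∀ ξ : D.domain, ⟪(ξ : H), B ξ⟫_ℂ = 0 := fun ξ => by
    simp only [B]
    rw [inner_sub_right, inner_smul_right, inner_hasDerivAt_eq hD ξ (hA ξ), sub_self]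
  have hBadd : ∀ ξ η, B (ξ + η) = B ξ + B η := fun ξ η => by
    simp only [B]
    rw [hadd, LinearPMap.map_add, smul_add]
    abel
  have hBsmul : ∀ (c : ℂ) ξ, B (c • ξ) = c • B ξ := fun c ξ => by
    simp only [B]
    rw [hsmul, LinearPMap.map_smul, smul_sub, smul_comm]
  have hBη : ∀ ξ η : D.domain, ⟪(η : H), B ξ⟫_ℂ = 0 := fun ξ η => by
    have h1 := hB0 (ξ + η)
    have h2 := hB0 (ξ + Complex.I • η)
    simp only [hBadd, hBsmul, Submodule.coe_add, Submodule.coe_smul, inner_add_left,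
      inner_add_right, inner_smul_left, inner_smul_right, hB0, Complex.conj_I] at h1 h2
    have h3 : ⟪(ξ : H), B η⟫_ℂ = -⟪(η : H), B ξ⟫_ℂ := by linear_combination h1
    rw [h3] at h2
    have h4 : Complex.I * ⟪(η : H), B ξ⟫_ℂ = 0 := by linear_combination -h2 / 2
    simpa using h4
  have : B ξ = 0 := hD.dense_domain.eq_zero_of_inner_right ℂ fun η hη => hBη ξ ⟨η, hη⟩
  have h5 : A ξ = Complex.I • D ξ := sub_eq_zero.1 this
  exact h5 ▸ hA ξ

theorem hasDerivAt_expI {ξ A : H} (hA : HasDerivAt (fun k => expI D k ξ) A 0) (k : ℝ) :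
    HasDerivAt (fun k => expI D k ξ) (expI D k A) k := by
  have h1 : HasDerivAt (fun l => expI D (l - k) ξ) A k :=
    HasDerivAt.comp_sub_const k k (by rwa [sub_self])
  have h2 := ((expI D k).restrictScalars ℝ).hasFDerivAt.comp_hasDerivAt k h1
  refine h2.congr_of_eventuallyEq (Eventually.of_forall fun l => ?_)
  have : expI D l = expI D k * expI D (l - k) := by rw [← expI_add, add_sub_cancel]
  simp only [this]
  rfl

end QuantumWalk

/-! ### Smooth vectors and moments -/

namespace QuantumWalk

open SpectralRep ProjectionValuedMeasure

variable {H : Type*} [NormedAddCommGroup H] [InnerProductSpace ℂ H] [CompleteSpace H]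
variable {D : H →ₗ.[ℂ] H}

/-- The orbit of `ξ` under the unitary group. -/
noncomputable def orbit (D : H →ₗ.[ℂ] H) (ξ : H) (k : ℝ) : H := expI D k ξ

theorem deriv_orbit {ξ A : H} (hA : HasDerivAt (orbit D ξ) A 0) : deriv (orbit D ξ) = orbit D A :=
  funext fun k => (hasDerivAt_expI hA k).deriv

/-- One extra power of `D` is spent so that the base case obtains continuity from differentiability.
-/
theorem contDiff_orbit_of_memDomainPow (hD : IsSelfAdjoint D) (n : ℕ) :
    ∀ ξ : H, MemDomainPow D (n + 1) ξ → ContDiff ℝ n (orbit D ξ) := by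
  induction n with
  | zero =>
    rintro ξ ⟨h, -⟩
    have hA := hasDerivAt_expI_zero hD ⟨ξ, h⟩
    rw [Nat.cast_zero, contDiff_zero]
    exact (show Differentiable ℝ (orbit D ξ) from
      fun k => (hasDerivAt_expI hA k).differentiableAt).continuous
  | succ n ih =>
    rintro ξ ⟨h, hm⟩
    have hA := hasDerivAt_expI_zero hD ⟨ξ, h⟩
    rw [Nat.cast_succ, contDiff_succ_iff_deriv]
    refine ⟨fun k => (hasDerivAt_expI hA k).differentiableAt, fun h => by simp at h, ?_⟩
    rw [deriv_orbit hA]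
    have h2 : orbit D (Complex.I • D ⟨ξ, h⟩) = fun k => Complex.I • orbit D (D ⟨ξ, h⟩) k :=
      funext fun k => map_smul _ _ _
    rw [h2]
    exact ContDiff.const_smul Complex.I (ih _ hm)

theorem contDiff_orbit (hD : IsSelfAdjoint D) {ξ : H} (hξ : IsSmoothVector D ξ) :
    ContDiff ℝ ∞ (orbit D ξ) :=
  contDiff_infty.2 fun n => contDiff_orbit_of_memDomainPow hD n ξ (hξ (n + 1))

/-- Differentiating the orbit once replaces `ξ` by its derivative `A` at `0` and multiplies the
spectral measure by `x²`; induction on `m` lowers the moment by two each time. -/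
theorem moment_eq (m : ℕ) : ∀ ξ : H, ContDiff ℝ ∞ (orbit D ξ) →
    Integrable (fun x : ℝ => x ^ (2 * m)) ((spectralMeasure D).measure ξ) ∧
      ∫ x : ℝ, x ^ (2 * m) ∂((spectralMeasure D).measure ξ) =
        ‖iteratedDeriv m (orbit D ξ) 0‖ ^ 2 := by
  induction m with
  | zero =>
    intro ξ _
    simp only [mul_zero, pow_zero, iteratedDeriv_zero, orbit, norm_expI_apply]
    refine ⟨integrable_const 1, ?_⟩
    rw [integral_const, measureReal_apply _ ξ MeasurableSet.univ, proj_univ, one_apply_eq_self]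
    simp
  | succ m ih =>
    intro ξ hξ
    obtain ⟨A, hA⟩ : ∃ A, HasDerivAt (orbit D ξ) A 0 :=
      ⟨_, (hξ.differentiable (by simp) 0).hasDerivAt⟩
    have hA' := deriv_orbit hA
    have hsm : ContDiff ℝ ∞ (orbit D A) := by
      rw [← hA']
      exact (contDiff_infty_iff_deriv.1 hξ).2
    obtain ⟨h1, h2⟩ := ih A hsm
    rw [iteratedDeriv_succ', hA', ← h2]
    rw [measure_eq_withDensity_of_hasDerivAt hA] at h1 ⊢
    rw [integral_withDensity_eq_integral_smul (by fun_prop)]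
    rw [integrable_withDensity_iff_integrable_smul (by fun_prop)] at h1
    have h3 : ∀ x : ℝ, (‖x‖₊ ^ 2 : NNReal) • x ^ (2 * m) = x ^ (2 * (m + 1)) := fun x => by
      rw [NNReal.smul_def, NNReal.coe_pow, coe_nnnorm, Real.norm_eq_abs, sq_abs, smul_eq_mul]
      ring
    simp_rw [h3] at h1 ⊢
    exact ⟨h1, trivial⟩

theorem integrable_pow (m : ℕ) {ξ : H} (hξ : ContDiff ℝ ∞ (orbit D ξ)) :
    Integrable (fun x : ℝ => x ^ m) ((spectralMeasure D).measure ξ) := by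
  refine Integrable.mono' ((integrable_const (1 : ℝ)).add (moment_eq m ξ hξ).1)
    (by fun_prop) (ae_of_all _ fun x => ?_)
  simp only [Pi.add_apply]
  rw [norm_pow, Real.norm_eq_abs, mul_comm, pow_mul, ← sq_abs (x ^ m), abs_pow]
  nlinarith [sq_nonneg (|x| ^ m - 1), pow_nonneg (abs_nonneg x) m]

/-! ### Smooth operators -/

/-- The conjugated operator `e^{ikD} X e^{-ikD}`. -/
noncomputable def conj (D : H →ₗ.[ℂ] H) (X : H →L[ℂ] H) (k : ℝ) : H →L[ℂ] H :=
  expI D k * X * expI D (-k)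

/-- Writing the new orbit as a product of two smooth functions of `k` is what makes the Leibniz rule
applicable. -/
theorem orbit_map (X : H →L[ℂ] H) (ξ : H) (k : ℝ) :
    orbit D (X ξ) k = conj D X k (orbit D ξ k) := by
  rw [conj, orbit, orbit, mul_apply_eq_comp, expI_neg_apply, mul_apply_eq_comp]

/-- Evaluation of bounded operators, as a real bilinear map. -/
noncomputable def evalBilin (H : Type*) [NormedAddCommGroup H] [InnerProductSpace ℂ H] :
    (H →L[ℂ] H) →L[ℝ] H →L[ℝ] H :=
  (ContinuousLinearMap.id ℂ (H →L[ℂ] H)).bilinearRestrictScalars ℝ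

theorem evalBilin_apply (X : H →L[ℂ] H) (ξ : H) : evalBilin H X ξ = X ξ := rfl

theorem norm_evalBilin_le : ‖evalBilin H‖ ≤ 1 := by
  rw [evalBilin, ContinuousLinearMap.norm_bilinearRestrictScalars]
  exact ContinuousLinearMap.norm_id_le

theorem orbit_map_eq (X : H →L[ℂ] H) (ξ : H) :
    orbit D (X ξ) = fun k => evalBilin H (conj D X k) (orbit D ξ k) :=
  funext fun k => orbit_map X ξ k

theorem contDiff_orbit_map {X : H →L[ℂ] H} (hX : IsSmoothOperator D X) {ξ : H}
    (hξ : ContDiff ℝ ∞ (orbit D ξ)) : ContDiff ℝ ∞ (orbit D (X ξ)) := by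
  rw [orbit_map_eq]
  exact (evalBilin H).isBoundedBilinearMap.contDiff.comp (ContDiff.prodMk hX hξ)

theorem norm_iteratedDeriv_orbit_map_le {X : H →L[ℂ] H} (hX : IsSmoothOperator D X) {ξ : H}
    (hξ : ContDiff ℝ ∞ (orbit D ξ)) (m : ℕ) :
    ‖iteratedDeriv m (orbit D (X ξ)) 0‖ ≤ ∑ i ∈ Finset.range (m + 1),
      (m.choose i : ℝ) * ‖iteratedDeriv i (conj D X) 0‖ *
        ‖iteratedDeriv (m - i) (orbit D ξ) 0‖ := by
  have h := (evalBilin H).norm_iteratedFDeriv_le_of_bilinear_of_le_one (N := ∞) hX hξ 0 (n := m)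
    (by exact_mod_cast le_top) norm_evalBilin_le
  simp_rw [norm_iteratedFDeriv_eq_norm_iteratedDeriv] at h
  rw [orbit_map_eq]
  exact h

theorem hasDerivAt_orbit_map {X : H →L[ℂ] H} (hX : IsSmoothOperator D X) {ξ A : H}
    (hA : HasDerivAt (orbit D ξ) A 0) :
    HasDerivAt (orbit D (X ξ)) (deriv (conj D X) 0 ξ + X A) 0 := by
  have h1 : HasDerivAt (conj D X) (deriv (conj D X) 0) 0 :=
    (ContDiff.differentiable hX (by simp) 0).hasDerivAt
  have h2 := (evalBilin H).hasFDerivAt_of_bilinear h1.hasFDerivAt hA.hasFDerivAt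
  have h3 := h2.hasDerivAt
  rw [← orbit_map_eq] at h3
  convert h3 using 1
  simp only [add_apply, ContinuousLinearMap.precompR_apply, ContinuousLinearMap.precompL_apply,
    evalBilin_apply, conj, orbit, expI_zero, neg_zero, one_mul, mul_one]
  simp [add_comm, evalBilin_apply]

/-- Differentiability of the orbit of `X ξ` puts `X ξ` in the domain, and comparing its two
derivatives identifies the derivative of the conjugated operator at `0` with `i [D, X]`. -/
theorem map_mem_domain (hD : IsSelfAdjoint D) {X : H →L[ℂ] H} (hX : IsSmoothOperator D X)
    (ξ : D.domain) : ∃ h : X ξ ∈ D.domain,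
      Complex.I • (D ⟨X ξ, h⟩ - X (D ξ)) = deriv (conj D X) 0 (ξ : H) := by
  have h1 := hasDerivAt_orbit_map hX (hasDerivAt_expI_zero hD ξ)
  have h := mem_domain_of_hasDerivAt hD h1
  refine ⟨h, ?_⟩
  have h2 := (hasDerivAt_expI_zero hD ⟨X ξ, h⟩).unique h1
  rw [map_smul] at h2
  rw [smul_sub, h2, add_sub_cancel_right]

theorem norm_commutator_apply (hD : IsSelfAdjoint D) {X : H →L[ℂ] H}
    (hX : IsSmoothOperator D X) (ξ : D.domain) (h : X ξ ∈ D.domain) :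
    ‖D ⟨X ξ, h⟩ - X (D ξ)‖ = ‖deriv (conj D X) 0 (ξ : H)‖ := by
  obtain ⟨h', h2⟩ := map_mem_domain hD hX ξ
  rw [← h2, norm_smul, Complex.norm_I, one_mul]

theorem commutatorNorm_lt_top (hD : IsSelfAdjoint D) {X : H →L[ℂ] H}
    (hX : IsSmoothOperator D X) : commutatorNorm D X < ⊤ := by
  refine lt_of_le_of_lt (iSup_le fun ξ => iSup_le fun h => iSup_le fun h1 => ?_)
    (ENNReal.ofReal_lt_top (r := ‖deriv (conj D X) 0‖))
  rw [← ofReal_norm, norm_commutator_apply hD hX]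
  refine ENNReal.ofReal_le_ofReal ((ContinuousLinearMap.le_opNorm _ _).trans ?_)
  exact mul_le_of_le_one_right (norm_nonneg _) h1

/-- The commutator norm controls the bounded extension of `i [D, X]` on the domain only; density of
the domain transfers the bound to all vectors. -/
theorem norm_deriv_conj_le (hD : IsSelfAdjoint D) {X : H →L[ℂ] H}
    (hX : IsSmoothOperator D X) :
    ‖deriv (conj D X) 0‖ ≤ (commutatorNorm D X).toReal := by
  set c := (commutatorNorm D X).toReal with hc
  set T := deriv (conj D X) 0 with hT
  have h1 : ∀ ξ : D.domain, ‖(ξ : H)‖ ≤ 1 → ‖T ξ‖ ≤ c := fun ξ hξ => by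
    obtain ⟨h, -⟩ := map_mem_domain hD hX ξ
    rw [hT, ← norm_commutator_apply hD hX ξ h, hc,
      ← ENNReal.ofReal_le_iff_le_toReal (commutatorNorm_lt_top hD hX).ne, ofReal_norm]
    exact le_iSup_of_le ξ (le_iSup_of_le h (le_iSup_of_le hξ le_rfl))
  have h2 : ∀ ξ ∈ (D.domain : Set H), ‖T ξ‖ ≤ c * ‖ξ‖ := fun ξ hξ => by
    by_cases h0 : ξ = 0
    · simp [h0]
    have hpos : 0 < ‖ξ‖ := norm_pos_iff.2 h0
    have h3 := h1 ⟨((‖ξ‖⁻¹ : ℝ) : ℂ) • ξ, D.domain.smul_mem _ hξ⟩ (by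
      simp [norm_smul, hpos.ne'])
    simp only [map_smul, norm_smul, Complex.norm_real, norm_inv, norm_norm] at h3
    rwa [inv_mul_le_iff₀ hpos, mul_comm] at h3
  refine ContinuousLinearMap.opNorm_le_bound _ ENNReal.toReal_nonneg fun ξ => ?_
  have hcl : IsClosed {ξ : H | ‖T ξ‖ ≤ c * ‖ξ‖} := isClosed_le (by fun_prop) (by fun_prop)
  exact hcl.closure_subset_iff.2 h2 (hD.dense_domain ξ)

/-! ### Growth of moments -/

/-- A discrete Grönwall-type estimate for a Leibniz recursion. -/
theorem exists_growth_bound {F : ℕ → ℕ → ℝ} {a : ℕ → ℝ} {c c' : ℝ} (hc : 0 ≤ c) (hcc : c < c')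
    (hF : ∀ t m, 0 ≤ F t m) (ha : ∀ i, 0 ≤ a i) (ha0 : a 0 ≤ 1) (ha1 : a 1 ≤ c)
    (hF0 : F 0 0 ≤ 1)
    (hrec : ∀ t m, F (t + 1) m ≤
      ∑ i ∈ Finset.range (m + 1), (m.choose i : ℝ) * a i * F t (m - i)) (m : ℕ) :
    ∃ K : ℝ, 0 ≤ K ∧ ∀ t : ℕ, F t m ≤ c' ^ m * (t + K) ^ m := by
  have hc' : 0 < c' := hc.trans_lt hcc
  induction m using Nat.strong_induction_on with
  | _ m ih =>
    rcases m with _ | m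
    · refine ⟨0, le_rfl, fun t => ?_⟩
      simp only [pow_zero, mul_one]
      induction t with
      | zero => exact hF0
      | succ t iht =>
        have := hrec t 0
        simp only [zero_add, Finset.range_one, Finset.sum_singleton, Nat.choose_self,
          Nat.cast_one, one_mul, Nat.sub_zero] at this
        exact this.trans (mul_le_one₀ ha0 (hF t 0) iht)
    · choose! K hK0 hK using ih
      -- `C` collects the terms of the recursion of order at least two. `δ` is the room left in
      -- first order, since `(x + 1)^(m+1) ≥ x^(m+1) + (m+1) x^m` offers the coefficient `(m+1)
      -- c'^(m+1)` while the recursion uses only `(m+1) c c'^m`.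
      set C : ℝ := ∑ i ∈ Finset.range m,
        ((m + 1).choose (i + 2) : ℝ) * a (i + 2) * c' ^ (m - 1 - i) with hC
      have hC0 : 0 ≤ C := Finset.sum_nonneg fun i _ => by
        have := ha (i + 2)
        positivity
      set δ : ℝ := (m + 1) * c' ^ m * (c' - c) with hδ
      have hδ0 : 0 < δ := by
        have : 0 < c' - c := sub_pos.2 hcc
        positivity
      -- One summand per requirement: `t + K' ≥ 1`, absorption of `C` by `δ (t + K')`, the initial
      -- value at `t = 0`, and domination of the constants of all lower orders.
      set K' : ℝ := 1 + C / δ + F 0 (m + 1) / c' ^ (m + 1) + ∑ i ∈ Finset.range (m + 1), K i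
        with hK'
      have hKs : ∀ i ∈ Finset.range (m + 1), 0 ≤ K i := fun i hi => hK0 i (Finset.mem_range.1 hi)
      have hs := Finset.sum_nonneg hKs
      have h0 : 0 ≤ C / δ := by positivity
      have h0' : 0 ≤ F 0 (m + 1) / c' ^ (m + 1) := div_nonneg (hF _ _) (by positivity)
      have hK1 : 1 ≤ K' := by linarith
      have hKi : ∀ i, i < m + 1 → K i ≤ K' := fun i hi => by
        have := Finset.single_le_sum hKs (Finset.mem_range.2 hi)
        linarith
      have hb : ∀ t j, j < m + 1 → F t j ≤ c' ^ j * (t + K') ^ j := fun t j hj => by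
        refine (hK j hj t).trans ?_
        have := hKi j hj
        have := hK0 j hj
        gcongr
      refine ⟨K', by linarith, fun t => ?_⟩
      induction t with
      | zero =>
        have h1 : F 0 (m + 1) ≤ c' ^ (m + 1) * K' := by
          rw [← div_le_iff₀' (by positivity)]
          linarith
        refine h1.trans ?_
        rw [Nat.cast_zero, zero_add]
        gcongr
        exact le_self_pow₀ hK1 (by simp)
      | succ t iht =>
        set x : ℝ := t + K' with hx
        have hx1 : 1 ≤ x := by
          have : (0 : ℝ) ≤ t := t.cast_nonneg
          linarith
        have hxC : C ≤ δ * x := by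
          rw [← div_le_iff₀' hδ0]
          have : (0 : ℝ) ≤ t := t.cast_nonneg
          linarith
        have h1 := hrec t (m + 1)
        rw [Finset.sum_range_succ', Finset.sum_range_succ'] at h1
        simp only [zero_add, Nat.choose_zero_right, Nat.cast_one, one_mul, Nat.sub_zero,
          Nat.choose_one_right, Nat.add_sub_cancel] at h1
        have h2 : a 0 * F t (m + 1) ≤ c' ^ (m + 1) * x ^ (m + 1) :=
          (mul_le_of_le_one_left (hF _ _) ha0).trans iht
        have h3 : ((m + 1 : ℕ) : ℝ) * a 1 * F t m ≤ (m + 1) * c * (c' ^ m * x ^ m) := by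
          have h4 := hb t m (Nat.lt_succ_self m)
          have h5 := hF t m
          have h6 := ha 1
          push_cast
          gcongr
        have h7 : ∑ i ∈ Finset.range m, ((m + 1).choose (i + 1 + 1) : ℝ) * a (i + 1 + 1) *
            F t (m + 1 - (i + 1 + 1)) ≤ δ * x ^ m := by
          rcases m with _ | m
          · simp
            positivity
          have h8 : ∑ i ∈ Finset.range (m + 1), ((m + 1 + 1).choose (i + 1 + 1) : ℝ) *
              a (i + 1 + 1) * F t (m + 1 + 1 - (i + 1 + 1)) ≤ C * x ^ m := by
            rw [hC, Finset.sum_mul]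
            refine Finset.sum_le_sum fun i hi => ?_
            rw [mul_assoc _ _ (x ^ m)]
            have hi' : i ≤ m := Nat.lt_succ_iff.1 (Finset.mem_range.1 hi)
            have h9 : m + 1 + 1 - (i + 1 + 1) = m - i := by omega
            have h10 : m + 1 - 1 - i = m - i := by omega
            rw [h9, h10]
            have h11 : F t (m - i) ≤ c' ^ (m - i) * x ^ m := by
              refine (hb t (m - i) (by omega)).trans ?_
              gcongr
              omega
            have h12 := ha (i + 1 + 1)
            gcongr
          calc _ ≤ C * x ^ m := h8
            _ ≤ δ * x * x ^ m := by gcongr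
            _ = δ * x ^ (m + 1) := by ring
        have h13 : ((m : ℝ) + 1) * x ^ m + x ^ (m + 1) ≤ (x + 1) ^ (m + 1) := by
          have hsum : (x + 1) ^ (m + 1) = ∑ i ∈ Finset.range (m + 2),
              x ^ i * ((m + 1).choose i : ℝ) := by
            rw [add_pow]
            simp
          rw [hsum, Finset.sum_range_succ, Finset.sum_range_succ]
          have : 0 ≤ ∑ i ∈ Finset.range m, x ^ i * ((m + 1).choose i : ℝ) :=
            Finset.sum_nonneg fun i _ => by positivity
          simp
          linarith
        have hcast : ((t + 1 : ℕ) : ℝ) + K' = x + 1 := by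
          push_cast
          ring
        rw [hcast]
        calc F (t + 1) (m + 1) ≤ δ * x ^ m + (m + 1) * c * (c' ^ m * x ^ m) +
              c' ^ (m + 1) * x ^ (m + 1) := by linarith
          _ = c' ^ (m + 1) * (((m : ℝ) + 1) * x ^ m + x ^ (m + 1)) := by
            rw [hδ]
            ring
          _ ≤ c' ^ (m + 1) * (x + 1) ^ (m + 1) := by gcongr

/-- The moments of the position distributions of a smooth walk grow at most ballistically. -/
theorem exists_moment_bound (hD : IsSelfAdjoint D) {U : unitary (H →L[ℂ] H)}
    (hU : IsSmoothOperator D (U : H →L[ℂ] H)) {ξ : H} (hξ : ContDiff ℝ ∞ (orbit D ξ))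
    (hξ1 : ‖ξ‖ = 1) {c' : ℝ} (hc' : (commutatorNorm D (U : H →L[ℂ] H)).toReal < c') (m : ℕ) :
    ∃ K : ℝ, 0 ≤ K ∧ ∀ t : ℕ,
      ∫ x : ℝ, x ^ (2 * m) ∂((spectralMeasure D).measure
        (((U ^ t : unitary (H →L[ℂ] H)) : H →L[ℂ] H) ξ)) ≤ (c' ^ m * (t + K) ^ m) ^ 2 := by
  set V : ℕ → H := fun t => ((U ^ t : unitary (H →L[ℂ] H)) : H →L[ℂ] H) ξ with hV
  have hV1 : ∀ t, V (t + 1) = (U : H →L[ℂ] H) (V t) := fun t => by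
    simp only [hV, pow_succ']
    rfl
  have hsm : ∀ t, ContDiff ℝ ∞ (orbit D (V t)) := fun t => by
    induction t with
    | zero => simpa [hV] using hξ
    | succ t ih =>
      rw [hV1]
      exact contDiff_orbit_map hU ih
  have hV0 : V 0 = ξ := by simp [hV]
  obtain ⟨K, hK0, hK⟩ := exists_growth_bound
    (F := fun t m => ‖iteratedDeriv m (orbit D (V t)) 0‖)
    (a := fun i => ‖iteratedDeriv i (conj D (U : H →L[ℂ] H)) 0‖)
    ENNReal.toReal_nonneg hc' (fun _ _ => norm_nonneg _) (fun _ => norm_nonneg _)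
    (by
      simp only [iteratedDeriv_zero, conj, expI_zero, neg_zero, one_mul, mul_one]
      have : Nontrivial H := nontrivial_of_ne ξ 0 fun h => by simp [h] at hξ1
      exact (CStarRing.norm_coe_unitary U).le)
    (by
      simp only [iteratedDeriv_one]
      exact norm_deriv_conj_le hD hU)
    (by simp [orbit, hV0, hξ1])
    (fun t m => by
      simp only [hV1]
      exact norm_iteratedDeriv_orbit_map_le hU (hsm t) m) m
  refine ⟨K, hK0, fun t => ?_⟩
  rw [(moment_eq m (V t) (hsm t)).2]
  have := hK t
  gcongr

end QuantumWalk

/-! ### Sequences of measures with controlled moments -/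

namespace MomentControl

/-- The complement of the open interval `(-L, L)`. -/
def tail (L : ℝ) : Set ℝ := {v | L ≤ |v|}

theorem measurableSet_tail (L : ℝ) : MeasurableSet (tail L) :=
  measurableSet_le measurable_const (by fun_prop)

theorem tail_eq (L : ℝ) : tail L = Set.Iic (-L) ∪ Set.Ici L := by
  ext v
  simp only [tail, Set.mem_ofPred_eq, le_abs, Set.mem_union, Set.mem_Iic, Set.mem_Ici]
  constructor <;> rintro (h | h) <;> [right; left; right; left] <;> linarith

variable {q : Measure ℝ}

theorem integrable_abs_pow (hq : ∀ m : ℕ, Integrable (fun v : ℝ => v ^ m) q) (m : ℕ) :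
    Integrable (fun v : ℝ => |v| ^ m) q := by
  simpa using (hq m).abs

/-- Markov's inequality: on the tail `|v|^m ≤ L^m (|v| / L)^(2 (m + i))`. The parameter `i` is free,
to be sent to infinity. -/
theorem setIntegral_tail_le (hq : ∀ m : ℕ, Integrable (fun v : ℝ => v ^ m) q) {L : ℝ}
    (hL : 0 < L) (m i : ℕ) :
    ∫ v in tail L, |v| ^ m ∂q ≤ L ^ m * (L ^ (2 * (m + i)))⁻¹ * ∫ v, v ^ (2 * (m + i)) ∂q := by
  have hnn : ∀ v : ℝ, 0 ≤ v ^ (2 * (m + i)) := fun v => by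
    rw [pow_mul]
    positivity
  calc ∫ v in tail L, |v| ^ m ∂q
      ≤ ∫ v in tail L, L ^ m * (L ^ (2 * (m + i)))⁻¹ * v ^ (2 * (m + i)) ∂q := by
        refine setIntegral_mono_on (integrable_abs_pow hq m).integrableOn
          ((hq _).const_mul _).integrableOn (measurableSet_tail L) fun v hv => ?_
        have hv' : L ≤ |v| := hv
        have h1 : v ^ (2 * (m + i)) = |v| ^ (2 * (m + i)) := by
          rw [pow_mul, pow_mul, sq_abs]
        rw [h1, mul_comm (L ^ m), mul_assoc, ← div_eq_inv_mul, le_div_iff₀ (by positivity),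
          show 2 * (m + i) = m + (m + 2 * i) by ring, pow_add L, pow_add |v|]
        calc |v| ^ m * (L ^ m * L ^ (m + 2 * i)) = L ^ m * (|v| ^ m * L ^ (m + 2 * i)) := by ring
          _ ≤ L ^ m * (|v| ^ m * |v| ^ (m + 2 * i)) := by gcongr
    _ ≤ ∫ v, L ^ m * (L ^ (2 * (m + i)))⁻¹ * v ^ (2 * (m + i)) ∂q :=
        setIntegral_le_integral ((hq _).const_mul _)
          (ae_of_all _ fun v => mul_nonneg (by positivity) (hnn v))
    _ = _ := integral_const_mul _ _

theorem tendsto_ratio {c' L : ℝ} (hc' : 0 ≤ c') (hL : c' < L) (m : ℕ) :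
    Tendsto (fun i : ℕ => L ^ m * (L ^ (2 * (m + i)))⁻¹ * c' ^ (2 * (m + i))) atTop (𝓝 0) := by
  have hL0 : 0 < L := hc'.trans_lt hL
  have h1 : Tendsto (fun n : ℕ => (c' / L) ^ n) atTop (𝓝 0) :=
    tendsto_pow_atTop_nhds_zero_of_lt_one (by positivity) ((div_lt_one hL0).2 hL)
  have h2 : Tendsto (fun i : ℕ => 2 * (m + i)) atTop atTop :=
    tendsto_atTop_mono (fun i => by simp only [id]; omega) tendsto_id
  have h3 := (h1.comp h2).const_mul (L ^ m)
  rw [mul_zero] at h3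
  refine h3.congr fun i => ?_
  simp only [Function.comp]
  rw [div_pow]
  ring

variable {p : ℕ → Measure ℝ} {c : ℝ}

/-- All moments of the measures are finite, and the even ones are asymptotically dominated by
those of measures supported in `[-c', c']`, for every `c' > c`. -/
structure Controlled (p : ℕ → Measure ℝ) (c : ℝ) : Prop where
  nonneg : 0 ≤ c
  prob : ∀ t, IsProbabilityMeasure (p t)
  integrable : ∀ t (m : ℕ), Integrable (fun v : ℝ => v ^ m) (p t)
  moment_le : ∀ c', c < c' → ∀ m : ℕ, ∀ᶠ t in atTop, ∫ v, v ^ (2 * m) ∂(p t) ≤ c' ^ (2 * m)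

/-- With `c < c' < L`, the moment bound leaves the factor `(c' / L)^(2 (m + i))`; `i` is fixed first
to make it small, and then `t` is taken large. -/
theorem Controlled.tendsto_setIntegral_tail (h : Controlled p c) {L : ℝ} (hL : c < L) (m : ℕ) :
    Tendsto (fun t => ∫ v in tail L, |v| ^ m ∂(p t)) atTop (𝓝 0) := by
  obtain ⟨c', hc', hc'L⟩ := exists_between hL
  have hc0 := h.nonneg
  have hL0 : 0 < L := by linarith
  rw [Metric.tendsto_atTop']
  intro ε hε
  obtain ⟨i, hi⟩ := ((tendsto_ratio (hc0.trans hc'.le) hc'L m).eventually (gt_mem_nhds hε)).exists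
  obtain ⟨N, hN⟩ := eventually_atTop.1 (h.moment_le c' hc' (m + i))
  refine ⟨N, fun t ht => ?_⟩
  rw [Real.dist_0_eq_abs, abs_of_nonneg (integral_nonneg fun v => by positivity)]
  refine lt_of_le_of_lt ((setIntegral_tail_le (h.integrable t) hL0 m i).trans ?_) hi
  have := hN t ht.le
  gcongr

theorem Controlled.tendsto_measureReal_tail (h : Controlled p c) {L : ℝ} (hL : c < L) :
    Tendsto (fun t => (p t).real (tail L)) atTop (𝓝 0) := by
  have := h.tendsto_setIntegral_tail hL 0
  simpa using this

theorem Controlled.tendsto_measure_tail (h : Controlled p c) {L : ℝ} (hL : c < L) :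
    Tendsto (fun t => p t (tail L)) atTop (𝓝 0) := by
  have := h.prob
  have h1 := ENNReal.tendsto_ofReal (h.tendsto_measureReal_tail hL)
  rw [ENNReal.ofReal_zero] at h1
  exact h1.congr fun t => ofReal_measureReal

theorem Controlled.measure_tail_of_weak (h : Controlled p c)
    (hq : QuantumWalk.WeaklyConvergesTo p q) {L : ℝ} (hL : c < L) : q (tail L) = 0 := by
  have := h.prob
  obtain ⟨hfin, hw⟩ := hq
  obtain ⟨L', hL', hL'L⟩ := exists_between hL
  -- A continuous function below the indicator of `tail L'` and strictly positive on `tail L`; its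
  -- limit integral is zero.
  let f : ℝ →ᵇ ℝ := BoundedContinuousFunction.ofNormedAddCommGroup
    (fun v => min 1 (max 0 (|v| - L'))) (by fun_prop) 1 fun v => by
      rw [Real.norm_eq_abs, abs_of_nonneg (le_min zero_le_one (le_max_left _ _))]
      exact min_le_left _ _
  have hf : ∀ v, f v = min 1 (max 0 (|v| - L')) := fun v => rfl
  have hf0 : ∀ v, 0 ≤ f v := fun v => le_min zero_le_one (le_max_left _ _)
  have h0 : Tendsto (fun t => ∫ v, f v ∂(p t)) atTop (𝓝 0) := by
    refine squeeze_zero (fun t => integral_nonneg hf0) (fun t => ?_)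
      (h.tendsto_measureReal_tail hL')
    rw [← integral_indicator_one (measurableSet_tail L')]
    refine integral_mono (f.integrable (p t))
      ((integrable_const (1 : ℝ)).indicator (measurableSet_tail L')) fun v => ?_
    by_cases hv : v ∈ tail L'
    · rw [Set.indicator_of_mem hv]
      exact min_le_left _ _
    · rw [Set.indicator_of_notMem hv, hf]
      have : |v| < L' := not_le.1 hv
      rw [max_eq_left (by linarith)]
      exact min_le_right _ _
  have h1 := tendsto_nhds_unique (hw f) h0
  rw [integral_eq_zero_iff_of_nonneg hf0 (f.integrable q)] at h1
  refine measure_mono_null (fun v hv => ?_) (ae_iff.1 h1)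
  have hv' : L ≤ |v| := hv
  simp only [Set.mem_ofPred_eq, Pi.zero_apply, hf]
  refine ne_of_gt (lt_min one_pos (lt_max_of_lt_right ?_))
  linarith

theorem Controlled.isCompact_support (h : Controlled p c)
    (hq : QuantumWalk.WeaklyConvergesTo p q) : IsCompact q.support := by
  refine (isCompact_Icc (a := -(c + 1)) (b := c + 1)).of_isClosed_subset Measure.isClosed_support
    (Measure.support_subset_of_isClosed isClosed_Icc ?_)
  rw [mem_ae_iff]
  refine measure_mono_null (fun v hv => ?_) (h.measure_tail_of_weak hq (lt_add_one c))
  by_contra hlt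
  have hlt' : |v| < c + 1 := not_le.1 hlt
  rw [abs_lt] at hlt'
  exact hv ⟨hlt'.1.le, hlt'.2.le⟩

/-- The test function is the `m`-th power of `v` clipped to `[-L, L]`. It equals `v^m` almost
everywhere for `q`, and for `p t` it differs from `v^m` only on the tail, by at most `2 |v|^m`. -/
theorem Controlled.momentsConvergeTo (h : Controlled p c)
    (hq : QuantumWalk.WeaklyConvergesTo p q) : QuantumWalk.MomentsConvergeTo p q := by
  intro m
  have := h.prob
  obtain ⟨hfin, hw⟩ := id hq
  set L := c + 1 with hLdef
  have hL : c < L := lt_add_one c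
  have hL0 : 0 < L := by linarith [h.nonneg]
  have hclip : ∀ v : ℝ, |max (-L) (min v L)| ≤ L := fun v =>
    abs_le.2 ⟨le_max_left _ _, max_le (by linarith) (min_le_right _ _)⟩
  have hclip' : ∀ v : ℝ, L ≤ |v| → |max (-L) (min v L)| ≤ |v| := fun v hv => (hclip v).trans hv
  let f : ℝ →ᵇ ℝ := BoundedContinuousFunction.ofNormedAddCommGroup
    (fun v => (max (-L) (min v L)) ^ m) (by fun_prop) (L ^ m) fun v => by
      rw [norm_pow, Real.norm_eq_abs]
      have := hclip v
      gcongr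
  have hf : ∀ v, f v = (max (-L) (min v L)) ^ m := fun v => rfl
  have hfeq : ∀ v, v ∉ tail L → f v = v ^ m := fun v hv => by
    have : |v| < L := not_le.1 hv
    rw [abs_lt] at this
    rw [hf, min_eq_left this.2.le, max_eq_right this.1.le]
  have hqe : (fun v : ℝ => v ^ m) =ᵐ[q] f := by
    have : ∀ᵐ v ∂q, v ∉ tail L := by
      rw [ae_iff]
      simpa using h.measure_tail_of_weak hq hL
    filter_upwards [this] with v hv
    exact (hfeq v hv).symm
  refine ⟨fun t => h.integrable t m, (f.integrable q).congr hqe.symm, ?_⟩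
  rw [integral_congr_ae hqe]
  have hdiff : Tendsto (fun t => ∫ v, (v ^ m - f v) ∂(p t)) atTop (𝓝 0) := by
    rw [tendsto_zero_iff_norm_tendsto_zero]
    have htail := (h.tendsto_setIntegral_tail hL m).const_mul 2
    rw [mul_zero] at htail
    refine squeeze_zero (fun t => norm_nonneg _) (fun t => ?_) htail
    refine (norm_integral_le_integral_norm _).trans ?_
    rw [← integral_const_mul, ← integral_indicator (measurableSet_tail L)]
    refine integral_mono ((h.integrable t m).sub (f.integrable (p t))).norm
      (((integrable_abs_pow (h.integrable t) m).const_mul 2).indicator (measurableSet_tail L))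
      fun v => ?_
    by_cases hv : v ∈ tail L
    · rw [Set.indicator_of_mem hv]
      refine (norm_sub_le _ _).trans ?_
      rw [hf, norm_pow, norm_pow, Real.norm_eq_abs, Real.norm_eq_abs, two_mul]
      have := hclip' v hv
      gcongr
    · rw [Set.indicator_of_notMem hv]
      simp [hfeq v hv]
  have := hdiff.add (hw f)
  rw [zero_add] at this
  refine this.congr fun t => ?_
  rw [integral_sub (h.integrable t m) (f.integrable (p t)), sub_add_cancel]

/-- The even moments of `q` inherit the bound `c'^(2i)` in the limit, so the tail has mass at most
`(c' / L)^(2i)` for every `i`. -/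
theorem Controlled.measure_tail_of_moments (h : Controlled p c) [IsFiniteMeasure q]
    (hq : QuantumWalk.MomentsConvergeTo p q) {L : ℝ} (hL : c < L) : q (tail L) = 0 := by
  obtain ⟨c', hc', hc'L⟩ := exists_between hL
  have hc0 := h.nonneg
  have hL0 : 0 < L := by linarith
  have hqi : ∀ m : ℕ, Integrable (fun v : ℝ => v ^ m) q := fun m => (hq m).2.1
  have hle : ∀ i : ℕ, q.real (tail L) ≤
      L ^ 0 * (L ^ (2 * (0 + i)))⁻¹ * c' ^ (2 * (0 + i)) := fun i => by
    have h1 := setIntegral_tail_le hqi hL0 0 i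
    have h2 : ∫ v, v ^ (2 * (0 + i)) ∂q ≤ c' ^ (2 * (0 + i)) :=
      le_of_tendsto (hq (2 * (0 + i))).2.2 (h.moment_le c' hc' (0 + i))
    have h3 : ∫ v in tail L, |v| ^ 0 ∂q = q.real (tail L) := by simp
    rw [h3] at h1
    refine h1.trans ?_
    gcongr
  have h0 := ge_of_tendsto' (tendsto_ratio (hc0.trans hc'.le) hc'L 0) hle
  exact (measureReal_eq_zero_iff).1 (le_antisymm h0 measureReal_nonneg)

/-- Inside `[-L, L]` the uniform error `ε` counts; outside, `f` and `P` are bounded separately, by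
`‖f‖` and by the sum of the absolute monomials. -/
theorem abs_integral_sub_polynomial_le (hq : ∀ m : ℕ, Integrable (fun v : ℝ => v ^ m) q)
    [IsFiniteMeasure q] (f : ℝ →ᵇ ℝ) (P : Polynomial ℝ) {L ε : ℝ} (hε : 0 ≤ ε)
    (hP : ∀ x ∈ Set.Icc (-L) L, |P.eval x - f x| < ε) :
    |∫ v, f v ∂q - ∫ v, P.eval v ∂q| ≤ ε * q.real Set.univ +
      (‖f‖ * ∫ v in tail L, |v| ^ 0 ∂q +
        ∑ i ∈ P.support, |P.coeff i| * ∫ v in tail L, |v| ^ i ∂q) := by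
  have hPeval : ∀ v, P.eval v = ∑ i ∈ P.support, P.coeff i * v ^ i := fun v =>
    Polynomial.eval_eq_sum
  have hPi : Integrable (fun v => P.eval v) q := by
    simp_rw [hPeval]
    exact integrable_finsetSum _ fun i _ => (hq i).const_mul _
  have hti : ∀ i : ℕ, Integrable ((tail L).indicator fun v => |v| ^ i) q := fun i =>
    (integrable_abs_pow hq i).indicator (measurableSet_tail L)
  have hsum : Integrable (fun v => ∑ i ∈ P.support,
      |P.coeff i| * (tail L).indicator (fun v => |v| ^ i) v) q :=
    integrable_finsetSum _ fun i _ => (hti i).const_mul _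
  have hbound : Integrable (fun v => ‖f‖ * (tail L).indicator (fun v => |v| ^ 0) v +
      ∑ i ∈ P.support, |P.coeff i| * (tail L).indicator (fun v => |v| ^ i) v) q :=
    ((hti 0).const_mul _).add hsum
  rw [← integral_sub (f.integrable q) hPi, ← Real.norm_eq_abs]
  refine (norm_integral_le_integral_norm _).trans ?_
  calc ∫ v, ‖f v - P.eval v‖ ∂q
      ≤ ∫ v, (ε + (‖f‖ * (tail L).indicator (fun v => |v| ^ 0) v +
        ∑ i ∈ P.support, |P.coeff i| * (tail L).indicator (fun v => |v| ^ i) v)) ∂q := by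
        refine integral_mono ((f.integrable q).sub hPi).norm
          ((integrable_const ε).add hbound) fun v => ?_
        simp only
        by_cases hv : v ∈ tail L
        · simp only [Set.indicator_of_mem hv]
          have h1 : ‖P.eval v‖ ≤ ∑ i ∈ P.support, |P.coeff i| * |v| ^ i := by
            rw [hPeval]
            refine (norm_sum_le _ _).trans (le_of_eq (Finset.sum_congr rfl fun i _ => ?_))
            rw [norm_mul, norm_pow, Real.norm_eq_abs, Real.norm_eq_abs]
          have h2 := norm_sub_le (f v) (P.eval v)
          have h3 := f.norm_coe_le_norm v
          rw [pow_zero, mul_one]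
          linarith
        · simp only [Set.indicator_of_notMem hv, mul_zero, Finset.sum_const_zero, add_zero]
          have hlt : |v| < L := not_le.1 hv
          rw [abs_lt] at hlt
          rw [Real.norm_eq_abs, abs_sub_comm]
          exact (hP v ⟨hlt.1.le, hlt.2.le⟩).le
    _ = _ := by
        rw [integral_add (integrable_const ε) hbound,
          integral_add ((hti 0).const_mul _) hsum,
          integral_finsetSum _ fun i _ => (hti i).const_mul _]
        simp_rw [integral_const_mul, integral_indicator (measurableSet_tail L)]
        rw [integral_const, smul_eq_mul, mul_comm ε]

theorem Controlled.weaklyConvergesTo (h : Controlled p c)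
    (hq : QuantumWalk.MomentsConvergeTo p q) : QuantumWalk.WeaklyConvergesTo p q := by
  have := h.prob
  have hfin : IsFiniteMeasure q := by
    have h0 := (hq 0).2.1
    simp only [pow_zero] at h0
    rwa [integrable_const_iff_isFiniteMeasure one_ne_zero] at h0
  refine ⟨hfin, fun f => ?_⟩
  set L := c + 1 with hLdef
  have hL : c < L := lt_add_one c
  have hqi : ∀ m : ℕ, Integrable (fun v : ℝ => v ^ m) q := fun m => (hq m).2.1
  have hqt : q.restrict (tail L) = 0 :=
    Measure.restrict_eq_zero.2 (h.measure_tail_of_moments hq hL)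
  rw [Metric.tendsto_atTop']
  intro ε hε
  set Q := q.real Set.univ with hQ
  have hQ0 : 0 ≤ Q := measureReal_nonneg
  -- The errors are `δ` (polynomial against `p t`), `δ / 2` (tail), `δ / 2` (convergence of the
  -- polynomial integrals) and `δ Q` (polynomial against `q`): in total `δ (2 + Q) = ε / 2`.
  set δ := ε / (2 * (2 + Q)) with hδ
  have hδ0 : 0 < δ := by positivity
  obtain ⟨P, hP⟩ := exists_polynomial_near_of_continuousOn (-L) L f f.continuous.continuousOn δ hδ0
  have hPeval : ∀ v, P.eval v = ∑ i ∈ P.support, P.coeff i * v ^ i := fun v =>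
    Polynomial.eval_eq_sum
  have hPt : Tendsto (fun t => ∫ v, P.eval v ∂(p t)) atTop (𝓝 (∫ v, P.eval v ∂q)) := by
    simp_rw [hPeval]
    rw [integral_finsetSum _ fun i _ => (hqi i).const_mul _]
    have : ∀ t, ∫ v, ∑ i ∈ P.support, P.coeff i * v ^ i ∂(p t) =
        ∑ i ∈ P.support, P.coeff i * ∫ v, v ^ i ∂(p t) := fun t => by
      rw [integral_finsetSum _ fun i _ => (h.integrable t i).const_mul _]
      simp_rw [integral_const_mul]
    simp_rw [this, integral_const_mul]
    exact tendsto_finsetSum _ fun i _ => (hq i).2.2.const_mul _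
  have hTt : Tendsto (fun t => ‖f‖ * ∫ v in tail L, |v| ^ 0 ∂(p t) +
      ∑ i ∈ P.support, |P.coeff i| * ∫ v in tail L, |v| ^ i ∂(p t)) atTop (𝓝 0) := by
    have h1 := ((h.tendsto_setIntegral_tail hL 0).const_mul ‖f‖).add
      (tendsto_finsetSum P.support fun i _ =>
        (h.tendsto_setIntegral_tail hL i).const_mul |P.coeff i|)
    simpa using h1
  have hq' := abs_integral_sub_polynomial_le hqi f P hδ0.le hP
  simp only [hqt, integral_zero_measure, mul_zero, Finset.sum_const_zero, add_zero] at hq'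
  have hev := (hTt.eventually (gt_mem_nhds (show 0 < δ / 2 by positivity))).and
    (Metric.tendsto_nhds.1 hPt (δ / 2) (by positivity))
  obtain ⟨N, hN⟩ := eventually_atTop.1 hev
  refine ⟨N, fun t ht => ?_⟩
  obtain ⟨h1, h2⟩ := hN t ht.le
  have h3 := abs_integral_sub_polynomial_le (h.integrable t) f P hδ0.le hP
  rw [probReal_univ, mul_one] at h3
  rw [Real.dist_eq] at h2 ⊢
  have h4 : δ * (2 + Q) < ε := by
    rw [hδ, div_mul_eq_mul_div, div_lt_iff₀ (by positivity)]
    nlinarith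
  have h5 : |∫ v, f v ∂(p t) - ∫ v, f v ∂q| ≤
      |∫ v, f v ∂(p t) - ∫ v, P.eval v ∂(p t)| + |∫ v, P.eval v ∂(p t) - ∫ v, P.eval v ∂q| +
      |∫ v, f v ∂q - ∫ v, P.eval v ∂q| := by
    rw [abs_sub_comm (∫ v, f v ∂q)]
    refine (abs_sub_le _ (∫ v, P.eval v ∂q) _).trans ?_
    gcongr
    exact abs_sub_le _ _ _
  nlinarith

end MomentControl

/-! ### Position distributions of smooth walks -/

namespace QuantumWalk

open ProjectionValuedMeasure

variable {H : Type*} [NormedAddCommGroup H] [InnerProductSpace ℂ H] [CompleteSpace H]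
variable {D : H →ₗ.[ℂ] H}

theorem contDiff_orbit_pow {U : unitary (H →L[ℂ] H)}
    (hU : IsSmoothOperator D (U : H →L[ℂ] H)) {ξ : H} (hξ : ContDiff ℝ ∞ (orbit D ξ)) (t : ℕ) :
    ContDiff ℝ ∞ (orbit D (((U ^ t : unitary (H →L[ℂ] H)) : H →L[ℂ] H) ξ)) := by
  induction t with
  | zero => simpa using hξ
  | succ t ih =>
    have := contDiff_orbit_map hU ih
    rwa [pow_succ']

theorem controlled_positionDistribution (hD : IsSelfAdjoint D) {U : unitary (H →L[ℂ] H)}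
    (hU : IsSmoothOperator D (U : H →L[ℂ] H)) {ξ : H} (hξ : ContDiff ℝ ∞ (orbit D ξ))
    (hξ1 : ‖ξ‖ = 1) :
    MomentControl.Controlled (positionDistribution D U ξ)
      (commutatorNorm D (U : H →L[ℂ] H)).toReal where
  nonneg := ENNReal.toReal_nonneg
  -- The value `t = 0` is included: division by zero gives `0`, so `p_0` is the point mass at `0`.
  prob t := by
    have h : IsProbabilityMeasure ((spectralMeasure D).measure
        (((U ^ t : unitary (H →L[ℂ] H)) : H →L[ℂ] H) ξ)) := ⟨by
      rw [ProjectionValuedMeasure.measure_univ, Unitary.norm_map, hξ1]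
      simp⟩
    exact Measure.isProbabilityMeasure_map (by fun_prop)
  integrable t m := by
    rw [positionDistribution, integrable_map_measure (by fun_prop) (by fun_prop)]
    have := (integrable_pow m (contDiff_orbit_pow hU hξ t)).div_const ((t : ℝ) ^ m)
    refine this.congr (ae_of_all _ fun x => ?_)
    simp only [Function.comp, div_pow]
  moment_le c' hc' m := by
    -- The growth bound is used with `b < c'`, so that `b (t + K) ≤ c' t` as soon as `t ≥ b K / (c'
    -- - b)`.
    obtain ⟨b, hb, hbc⟩ := exists_between hc'
    have hb0 : 0 ≤ b := ENNReal.toReal_nonneg.trans hb.le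
    obtain ⟨K, hK0, hK⟩ := exists_moment_bound hD hU hξ hξ1 hb m
    obtain ⟨N, hN⟩ := exists_nat_ge (b * K / (c' - b))
    filter_upwards [eventually_ge_atTop (N + 1)] with t ht
    have htN : (N : ℝ) + 1 ≤ t := by exact_mod_cast ht
    have ht0 : (0 : ℝ) < t := by
      have : (0 : ℝ) ≤ N := N.cast_nonneg
      linarith
    rw [positionDistribution, integral_map (by fun_prop) (by fun_prop)]
    simp_rw [div_pow]
    rw [integral_div, div_le_iff₀ (by positivity)]
    refine (hK t).trans ?_
    rw [← mul_pow, ← pow_mul, mul_comm m 2, ← mul_pow]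
    have h1 : b * K ≤ t * (c' - b) := by
      rw [← div_le_iff₀ (sub_pos.2 hbc)]
      linarith
    exact pow_le_pow_left₀ (by positivity) (by linarith) _

end QuantumWalk

theorem mainTheorem11 {H : Type*} [NormedAddCommGroup H] [InnerProductSpace ℂ H] [CompleteSpace H]
    (D : H →ₗ.[ℂ] H) (hD : IsSelfAdjoint D) (U : unitary (H →L[ℂ] H))
    (hU : QuantumWalk.IsSmoothWalk D U)
    (ξ : H) (hξ : QuantumWalk.IsSmoothVector D ξ) (hξ_norm : ‖ξ‖ = 1) :
    -- the commutator `[D, U]` is defined on the domain of `D`, and it is bounded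
    ((∀ η ∈ D.domain, (U : H →L[ℂ] H) η ∈ D.domain) ∧
      QuantumWalk.commutatorNorm D (U : H →L[ℂ] H) < ⊤) ∧
    -- the distributions `p_t` asymptotically vanish outside `(-L, L)`
    (∀ L : ℝ, QuantumWalk.commutatorNorm D (U : H →L[ℂ] H) < ENNReal.ofReal L →
      Tendsto (fun t : ℕ => QuantumWalk.positionDistribution D U ξ t (Set.Iic (-L) ∪ Set.Ici L))
        atTop (𝓝 0)) ∧
    -- any limit distribution has compact support
    (∀ q : Measure ℝ,
      QuantumWalk.WeaklyConvergesTo (QuantumWalk.positionDistribution D U ξ) q →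
        IsCompact q.support) ∧
    -- weak convergence is equivalent to convergence of moments
    (∀ q : Measure ℝ,
      QuantumWalk.WeaklyConvergesTo (QuantumWalk.positionDistribution D U ξ) q ↔
        QuantumWalk.MomentsConvergeTo (QuantumWalk.positionDistribution D U ξ) q) := by
  have hU1 : QuantumWalk.IsSmoothOperator D (U : H →L[ℂ] H) := by
    have := hU 1
    rwa [zpow_one] at this
  have hc := QuantumWalk.controlled_positionDistribution hD hU1
    (QuantumWalk.contDiff_orbit hD hξ) hξ_norm
  refine ⟨⟨fun η hη => (QuantumWalk.map_mem_domain hD hU1 ⟨η, hη⟩).1,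
    QuantumWalk.commutatorNorm_lt_top hD hU1⟩, fun L hL => ?_, fun q hq => hc.isCompact_support hq,
    fun q => ⟨hc.momentsConvergeTo, hc.weaklyConvergesTo⟩⟩
  rw [← MomentControl.tail_eq]
  exact hc.tendsto_measure_tail ((ENNReal.lt_ofReal_iff_toReal_lt hL.ne_top).1 hL)
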